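/- **Correlations between reset qudits in the noisy random convolutional circuit.** *Setting.* Let $q\ge 2$ and let $\Phi(\rho)=\sum_k E_k\rho E_k^\dagger$ be a quantum channel on one qudit ($\mathbb C^q$), $\sum_k E_k^\dagger E_k=1$. Put $$\alpha=\frac1{q^2}\sum_k|\mathrm{Tr}\,E_k|^2,\qquad \beta=\frac1{q^2}\sum_{k,l}|\mathrm{Tr}(E_kE_l)|^2 .$$ Start with $n$ qudits, numbered $1,\dots,n$, in the state $|0^n\rangle$, and let $U_1,\dots,U_{n-1}$ be independent Haar-random unitaries on $\mathbb C^q\otimes\mathbb C^q$. The convolutional circuit applies, for $k=1,\dots,n-1$ in this order, $U_k$ to the qudits $k,k+1$, followed by $\Phi$ on each of these two qudits. The idle qudits $1,\dots,n-1$ are then rewound: for $k=n-2,\dots,1$ in this order, $U_k^\dagger$ is applied to the qudits $k,k+1$, followed, if $k\ge2$, by $\Phi$ on qudit $k$. (Each qudit is read out directly after its last rewinding gate.) Let $\mathcal F_i$ be the probability that qudit $i$ is found in $|0\rangle$, averaged over the $U_k$, let $\mathcal F_{ij}$ be the averaged probability that the qudits $i$ and $j$ are both found in $|0\rangle$, and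 let $\mathcal F^c_{ij}=\mathcal F_{ij}-\mathcal F_i\mathcal F_j$. For real $\alpha,\beta$ put $$T=\frac1{q^4-1}\begin{pmatrix}q^2(q^2-\alpha)&(1-\alpha\beta)q^3\\ q(\alpha q^2-1)&\alpha\beta q^4-1\end{pmatrix},\qquad T_0=\frac1{q^4-1}\begin{pmatrix}q(q^2-\alpha)&(1-\alpha\beta)q^2\\ q(\alpha q^2-1)&\alpha\beta q^4-1\end{pmatrix},$$ let $\langle M\rangle=qA+B$ with $(A,B)^T=\frac1q M(1,0)^T$, and, for $2\le j<i<n$, let $$\mathcal F^c_{ij}(n;\alpha,\beta)=\langle T^{j-2}T_0T^{i-j-1}T_0T^{n-i-1}\rangle-\langle T^{i-2}T_0T^{n-i-1}\rangle\,\langle T^{j-2}T_0T^{n-j-1}\rangle .$$ *Statement.* Let $2\le j<i$, and for $\alpha\in[0,1]$ put $$L(\alpha)=\frac{(1-\alpha)\,q^2\,(\alpha q^2-1)}{(q+1)^2\,\big((1-\alpha)q^2+1\big)^2}\left(\frac{\alpha q^2}{q^2+1}\right)^{i-j}.$$ 1. For every noise channel and every $n>i$, $\mathcal F^c_{ij}=\mathcal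 F^c_{ij}(n;\alpha,\beta)$ with the $\alpha,\beta$ of the channel. 2. Every noise channel has $0\le\alpha\le1$, and if it has $\beta=1$, then $\lim_{n\to\infty}\mathcal F^c_{ij}=L(\alpha)$. 3. For every $\alpha\in[0,1]$, $\mathcal F^c_{ij}\to L(\alpha)$ jointly as $n\to\infty$ and the noise channel varies so that its parameters tend to $(\alpha,1)$; and, with $\alpha$ fixed and $\beta$ a free real parameter, $\lim_{n\to\infty,\ \beta\to1}\mathcal F^c_{ij}(n;\alpha,\beta)=L(\alpha)$ as a joint limit. 4. For every $\alpha\in[0,1]$, $0\le\frac{\alpha q^2}{q^2+1}<1$, so that $L(\alpha)$ decays exponentially in the distance $i-j$. -/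

import Mathlib

open Filter Topology MeasureTheory
open scoped Matrix

namespace NoisyConv

/-! ### Haar-random two-qudit gates -/

/-- Two-qudit gates: unitaries on `ℂ^q ⊗ ℂ^q`. -/
abbrev Gate (q : ℕ) : Type := Matrix.unitaryGroup (Fin q × Fin q) ℂ

noncomputable instance gateMeasurableSpace (q : ℕ) : MeasurableSpace (Gate q) := borel _

instance gateBorelSpace (q : ℕ) : BorelSpace (Gate q) := ⟨rfl⟩

instance gateCompactSpace (q : ℕ) : CompactSpace (Gate q) := by
  apply isCompact_iff_compactSpace.mp
  have hK : IsCompact (Set.pi Set.univ (fun _ : Fin q × Fin q =>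
      Set.pi Set.univ (fun _ : Fin q × Fin q => Metric.closedBall (0 : ℂ) 1))) :=
    isCompact_univ_pi fun _ => isCompact_univ_pi fun _ => isCompact_closedBall _ _
  refine IsCompact.of_isClosed_subset (t := (Matrix.unitaryGroup (Fin q × Fin q) ℂ :
    Set (Matrix (Fin q × Fin q) (Fin q × Fin q) ℂ))) hK ?_ ?_
  · have h : (Matrix.unitaryGroup (Fin q × Fin q) ℂ :
        Set (Matrix (Fin q × Fin q) (Fin q × Fin q) ℂ)) = {A | A * star A = 1} := by
      ext A
      exact Matrix.mem_unitaryGroup_iff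
    rw [h]
    exact isClosed_eq (by fun_prop) continuous_const
  · intro A hA x _ y _
    simpa using entry_norm_bound_of_unitary hA x y

/-- The normalised Haar measure on the group of two-qudit gates. -/
noncomputable def haarGate (q : ℕ) : Measure (Gate q) := Measure.haarMeasure ⊤

instance haarGate_isProbabilityMeasure (q : ℕ) : IsProbabilityMeasure (haarGate q) :=
  ⟨Measure.haarMeasure_self⟩

/-! ### Single-qudit noise channels -/

/-- A single-qudit noise channel `ρ ↦ ∑ₖ Eₖ ρ Eₖ†`, given by Kraus operators. -/
structure Noise (q : ℕ) where
  /-- the number of Kraus operators -/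
  rank : ℕ
  /-- the Kraus operators -/
  kraus : Fin rank → Matrix (Fin q) (Fin q) ℂ
  /-- trace preservation -/
  sum_conjTranspose_mul : ∑ k, (kraus k)ᴴ * kraus k = 1

/-- Entanglement fidelity `α` of the channel. -/
noncomputable def Noise.alpha {q : ℕ} (E : Noise q) : ℝ :=
  (∑ k, ‖(E.kraus k).trace‖ ^ 2) / (q : ℝ) ^ 2

/-- The parameter `β`, the entanglement fidelity of the channel applied twice. -/
noncomputable def Noise.beta {q : ℕ} (E : Noise q) : ℝ :=
  (∑ k, ∑ l, ‖(E.kraus k * E.kraus l).trace‖ ^ 2) / (q : ℝ) ^ 2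

/-! ### The register of `n` qudits -/

/-- Operators on `n` qudits, in the computational basis. -/
abbrev Op (n q : ℕ) : Type := Matrix (Fin n → Fin q) (Fin n → Fin q) ℂ

/-- The operator `A` acting on qudit `s` (identity elsewhere). -/
noncomputable def onQudit {n q : ℕ} (s : Fin n) (A : Matrix (Fin q) (Fin q) ℂ) : Op n q :=
  Matrix.of fun x y => if ∀ m, m ≠ s → x m = y m then A (x s) (y s) else 0

/-- The operator `A` acting on the pair of qudits `(s, t)` (identity elsewhere). -/
noncomputable def onPair {n q : ℕ} (s t : Fin n)
    (A : Matrix (Fin q × Fin q) (Fin q × Fin q) ℂ) : Op n q :=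
  Matrix.of fun x y =>
    if ∀ m, m ≠ s → m ≠ t → x m = y m then A (x s, x t) (y s, y t) else 0

/-- The density matrix of `|0ⁿ⟩`. -/
noncomputable def initialState (n q : ℕ) : Op n q :=
  Matrix.of fun x y =>
    if (∀ m, (x m : ℕ) = 0) ∧ (∀ m, (y m : ℕ) = 0) then 1 else 0

/-- The projector `|0⟩⟨0|` on the `i`-th qudit. Qudits are numbered `1, …, n`, so that the
`i`-th one has index `i - 1` in `Fin n`. -/
noncomputable def zeroProj (n q i : ℕ) : Op n q :=
  Matrix.diagonal fun x => if ∀ m : Fin n, (m : ℕ) + 1 = i → (x m : ℕ) = 0 then 1 else 0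

/-- The noise channel acting on qudit `s`. -/
noncomputable def noiseOn {n q : ℕ} (E : Noise q) (s : Fin n) (ρ : Op n q) : Op n q :=
  ∑ k, onQudit s (E.kraus k) * ρ * (onQudit s (E.kraus k))ᴴ

/-! ### The noisy convolutional circuit and its rewinding

There is one gate for each pair of neighbouring qudits, indexed by `k : Fin (n - 1)` and acting
on the qudits with indices `k` and `k + 1`. -/

/-- The first qudit of the `k`-th gate. -/
def fstQudit {n : ℕ} (k : Fin (n - 1)) : Fin n := ⟨k, by omega⟩

/-- The second qudit of the `k`-th gate. -/
def sndQudit {n : ℕ} (k : Fin (n - 1)) : Fin n := ⟨k + 1, by omega⟩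

/-- The `k`-th gate of the circuit as a unitary on the whole register. -/
noncomputable def gateOp {n q : ℕ} (U : Fin (n - 1) → Gate q) (k : Fin (n - 1)) : Op n q :=
  onPair (fstQudit k) (sndQudit k) (U k : Matrix (Fin q × Fin q) (Fin q × Fin q) ℂ)

/-- A step of the circuit: apply the `k`-th gate, then the noise on both of its qudits. -/
noncomputable def forwardStep {n q : ℕ} (E : Noise q) (U : Fin (n - 1) → Gate q)
    (ρ : Op n q) (k : Fin (n - 1)) : Op n q :=
  noiseOn E (sndQudit k) (noiseOn E (fstQudit k) (gateOp U k * ρ * (gateOp U k)ᴴ))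

/-- A step of the rewinding: apply the inverse of the `k`-th gate, then the noise on the qudit
that is passed on to the next rewinding gate. The inverse of the `k`-th gate is the last gate on
the qudit of index `k + 1` (and, if `k = 0`, on the qudit of index `0`); such a qudit is read out
directly after its last gate. -/
noncomputable def rewindStep {n q : ℕ} (E : Noise q) (U : Fin (n - 1) → Gate q)
    (ρ : Op n q) (k : Fin (n - 1)) : Op n q :=
  if (k : ℕ) = 0 then (gateOp U k)ᴴ * ρ * gateOp U k
  else noiseOn E (fstQudit k) ((gateOp U k)ᴴ * ρ * gateOp U k)

/-- The state after the noisy convolutional circuit `U_{[n-1,n]} ⋯ U_{[2,3]} U_{[1,2]}` on `|0ⁿ⟩`. -/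
noncomputable def circuitState {n q : ℕ} (E : Noise q) (U : Fin (n - 1) → Gate q) : Op n q :=
  (List.finRange (n - 1)).foldl (forwardStep E U) (initialState n q)

/-- The state after the noisy circuit and the noisy rewinding. The idle qudits are `1, …, n - 1`,
so all gates but the last one are undone, in reverse order. -/
noncomputable def rewoundState {n q : ℕ} (E : Noise q) (U : Fin (n - 1) → Gate q) : Op n q :=
  ((List.finRange (n - 1)).dropLast.reverse).foldl (rewindStep E U) (circuitState E U)

/-- `𝓕_i`: averaged fidelity of resetting the `i`-th qudit, over independent Haar-random gates. -/
noncomputable def fidelity {q : ℕ} (E : Noise q) (n i : ℕ) : ℝ :=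
  ∫ U : Fin (n - 1) → Gate q, (zeroProj n q i * rewoundState E U).trace.re
    ∂(Measure.pi fun _ => haarGate q)

/-- `𝓕_ij`: averaged fidelity of resetting both the `i`-th and the `j`-th qudit. -/
noncomputable def jointFidelity {q : ℕ} (E : Noise q) (n i j : ℕ) : ℝ :=
  ∫ U : Fin (n - 1) → Gate q, (zeroProj n q i * zeroProj n q j * rewoundState E U).trace.re
    ∂(Measure.pi fun _ => haarGate q)

/-- `𝓕_ij^c = 𝓕_ij - 𝓕_i 𝓕_j` for the noisy circuit. -/
noncomputable def connectedCorrelation {q : ℕ} (E : Noise q) (n i j : ℕ) : ℝ :=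
  jointFidelity E n i j - fidelity E n i * fidelity E n j

/-! ### The same quantities as functions of real parameters `α`, `β` -/

/-- The transfer matrix of a qudit that is not read out (basis `𝟏`, `𝐬`). -/
noncomputable def transfer (q : ℕ) (α β : ℝ) : Matrix (Fin 2) (Fin 2) ℝ :=
  !![(q : ℝ) ^ 2 * ((q : ℝ) ^ 2 - α) / ((q : ℝ) ^ 4 - 1),
      (1 - α * β) * (q : ℝ) ^ 3 / ((q : ℝ) ^ 4 - 1);
    (q : ℝ) * (α * (q : ℝ) ^ 2 - 1) / ((q : ℝ) ^ 4 - 1),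
      (α * β * (q : ℝ) ^ 4 - 1) / ((q : ℝ) ^ 4 - 1)]

/-- The transfer matrix of a qudit that is read out. -/
noncomputable def transferRead (q : ℕ) (α β : ℝ) : Matrix (Fin 2) (Fin 2) ℝ :=
  !![(q : ℝ) * ((q : ℝ) ^ 2 - α) / ((q : ℝ) ^ 4 - 1),
      (1 - α * β) * (q : ℝ) ^ 2 / ((q : ℝ) ^ 4 - 1);
    (q : ℝ) * (α * (q : ℝ) ^ 2 - 1) / ((q : ℝ) ^ 4 - 1),
      (α * β * (q : ℝ) ^ 4 - 1) / ((q : ℝ) ^ 4 - 1)]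

/-- `q A + B`, where `(A, B) = (1/q) M (1, 0)`. -/
noncomputable def boundaryValue (q : ℕ) (M : Matrix (Fin 2) (Fin 2) ℝ) : ℝ :=
  (q : ℝ) * (((1 / (q : ℝ)) • M) *ᵥ ![1, 0]) 0 + (((1 / (q : ℝ)) • M) *ᵥ ![1, 0]) 1

/-- `𝓕_i` as a function of `α`, `β` (for `2 ≤ i < n`). -/
noncomputable def formalFidelity (q : ℕ) (α β : ℝ) (n i : ℕ) : ℝ :=
  boundaryValue q
    (transfer q α β ^ (i - 2) * transferRead q α β * transfer q α β ^ (n - i - 1))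

/-- `𝓕_ij` as a function of `α`, `β` (for `2 ≤ j < i < n`). -/
noncomputable def formalJointFidelity (q : ℕ) (α β : ℝ) (n i j : ℕ) : ℝ :=
  boundaryValue q
    (transfer q α β ^ (j - 2) * transferRead q α β * transfer q α β ^ (i - j - 1) *
      transferRead q α β * transfer q α β ^ (n - i - 1))

/-- `𝓕_ij^c` as a function of `α`, `β` (for `2 ≤ j < i < n`). -/
noncomputable def formalCorrelation (q : ℕ) (α β : ℝ) (n i j : ℕ) : ℝ :=
  formalJointFidelity q α β n i j - formalFidelity q α β n i * formalFidelity q α β n j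

end NoisyConv

/-! The gates are independent and each occurs at most twice, as `V` and later as its inverse, so
they can be averaged one at a time, from the last to the first. The circuit is nested: outside gate
`k` and its inverse there remain earlier forward gates and their rewinding, which never touch qudits
further right. Averaging the inner gates therefore leaves a superoperator on a single qudit, and
this superoperator always has the form `a • id + b • D` with `D X = Tr(X) 1` (the map of
`unitFamily`). A computation in a space of dimension `q ^ (2n)` becomes a product of 2 × 2 matrices.

The Haar input is `twirl_eq`. The average of `V†AV ⊗ conj(V†BV)` is an invariant tensor, hence a
combination of the two index pairings (`exists_eq_of_unitary_invariant`), with coefficients fixed by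
`Tr A conj(Tr B)` and `Tr(AB†)`. Applied to Kraus operators (`integral_conj_krausMap`), one pairing
gives the identity and the other gives `D ⊗ D`. A noise channel then enters only through the trace
of a superoperator and the trace of its value at `1`, which yield `α`, `β` and powers of `q`
(`integral_noisy_gate`).

Next consider the outer qudit of the averaged gate. In the identity term it is still in `|0⟩`, so
its readout projector acts trivially. In the depolarised term it contributes the trace of its
observable: `1` if it is read, `q` if not. This is the whole difference between `transferRead` and
`transfer` (`integral_stageValue_succ`). The last gate, never undone, supplies the vector `(1/q,
0)`, and the untouched first qudit supplies the row `(q, 1)`.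

For the limit, `(q, 1)` is a left eigenvector of `transfer` with eigenvalue `1`, and the second
eigenvalue is `decayRate`, equal to `αq²/(q²+1) < 1` at `β = 1`. Long powers converge to the
projection onto `fixedVec`, with locally uniform control in the parameters. In the joint fidelity
the projection part of the power between the two readouts cancels the product of the fidelities, and
the other eigenspace leaves the exponential (`fixedVec_correlation`). `tendsto_formalCorrelation` is
stated along an arbitrary filter so that all three limits are instances of it. -/

/-! ### Tensors invariant under the unitary group -/

section InvariantTensor

open Matrix

variable {ι : Type*} [DecidableEq ι]

/-- The reflection `1 - (2/5) u uᵀ` with `u = e_s + 2 e_t`. -/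
noncomputable def pythagoreanReflection (s t : ι) : Matrix ι ι ℂ :=
  Matrix.of fun i j => (if i = j then 1 else 0) - 2 / 5 *
    (((if i = s then 1 else 0) + if i = t then 2 else 0) *
      ((if j = s then 1 else 0) + if j = t then 2 else 0))

theorem star_pythagoreanReflection_apply (s t i j : ι) :
    star (pythagoreanReflection s t i j) = pythagoreanReflection s t i j := by
  simp only [pythagoreanReflection, Matrix.of_apply]
  split_ifs <;> simp

/-- The triple (3, 4, 5) keeps all entries rational, so no square roots appear when four such
columns are multiplied. -/
theorem pythagoreanReflection_apply_left {s t : ι} (hst : s ≠ t) (i : ι) :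
    pythagoreanReflection s t i s =
      (if i = s then 3 / 5 else 0) + (if i = t then -4 / 5 else 0) := by
  by_cases h1 : i = s
  · subst h1; simp [pythagoreanReflection, hst]; norm_num
  · by_cases h2 : i = t
    · subst h2; simp [pythagoreanReflection, h1, hst]; norm_num
    · simp [pythagoreanReflection, h1, h2]

theorem pythagoreanReflection_mem_unitaryGroup [Fintype ι] {s t : ι} (hst : s ≠ t) :
    pythagoreanReflection s t ∈ unitaryGroup ι ℂ := by
  have hs : star (pythagoreanReflection s t) = pythagoreanReflection s t := by
    ext i j
    rw [Matrix.star_apply, star_pythagoreanReflection_apply]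
    simp only [pythagoreanReflection, Matrix.of_apply, eq_comm, mul_comm]
  rw [mem_unitaryGroup_iff, hs]
  set u : ι → ℂ := fun i => (if i = s then 1 else 0) + (if i = t then 2 else 0) with hu
  have husum : ∑ i, u i * u i = 5 := by
    have : ∀ i, u i * u i = (if i = s then 1 else 0) + (if i = t then 4 else 0) := by
      intro i
      by_cases h1 : i = s
      · subst h1; simp [hu, hst]
      · by_cases h2 : i = t
        · subst h2; simp [hu, h1]; norm_num
        · simp [hu, h1, h2]
    simp [this, Finset.sum_add_distrib]; norm_num
  have hR : ∀ i j, pythagoreanReflection s t i j =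
      (if i = j then 1 else 0) - 2 / 5 * (u i * u j) := fun i j => rfl
  ext i j
  have h : ∀ k, pythagoreanReflection s t i k * pythagoreanReflection s t k j =
      (if i = k then (if k = j then 1 else 0) else 0) - (if i = k then 2 / 5 * (u k * u j) else 0)
        - (if k = j then 2 / 5 * (u i * u k) else 0) + 4 / 25 * u i * u j * (u k * u k) := by
    intro k
    simp only [hR]
    split_ifs <;> ring
  simp only [Matrix.mul_apply, h, Finset.sum_add_distrib, Finset.sum_sub_distrib, ← Finset.mul_sum,
    husum, Finset.sum_ite_eq, Finset.sum_ite_eq', Finset.mem_univ, if_true, Matrix.one_apply]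
  ring

/-- A tensor of type `(2, 2)` that is invariant under the unitary group is a combination of the
two pairings of its indices. -/
theorem exists_eq_of_unitary_invariant [Fintype ι] [Nontrivial ι] (W : ι → ι → ι → ι → ℂ)
    (hW : ∀ V ∈ unitaryGroup ι ℂ, ∀ x y z w, W x y z w = ∑ x', ∑ y', ∑ z', ∑ w',
      star (V x' x) * V y' y * V z' z * star (V w' w) * W x' y' z' w') :
    ∃ a b : ℂ, ∀ x y z w, W x y z w =
      a * (if x = y ∧ z = w then 1 else 0) + b * (if x = z ∧ y = w then 1 else 0) := by
  -- Invariance under the diagonal unitary with a single phase `I` at `t`. A sign `-1` would not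
  -- suffice: it cannot exclude `W x y y x`, where the phase occurs twice.
  have hphase : ∀ t x y z w : ι, W x y z w =
      star (if x = t then Complex.I else 1) * (if y = t then Complex.I else 1) *
      (if z = t then Complex.I else 1) * star (if w = t then Complex.I else 1) * W x y z w := by
    intro t x y z w
    have hV : diagonal (fun x => if x = t then Complex.I else 1) ∈ unitaryGroup ι ℂ := by
      rw [mem_unitaryGroup_iff, star_eq_conjTranspose, diagonal_conjTranspose,
        diagonal_mul_diagonal, ← diagonal_one]
      congr 1; ext x; by_cases h : x = t <;> simp [h]
    have h := hW _ hV x y z w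
    simpa [diagonal_apply, apply_ite star, ite_mul, mul_ite, Finset.sum_ite_eq] using h
  have hzero : ∀ x y z w : ι, ¬ (x = y ∧ z = w) → ¬ (x = z ∧ y = w) → W x y z w = 0 := by
    intro x y z w h1 h2
    have key : ∀ c : ℂ, W x y z w = c * W x y z w → c ≠ 1 → W x y z w = 0 := by
      intro c hc hne
      by_contra h0
      exact hne (mul_right_cancel₀ h0 (by rw [← hc, one_mul]))
    by_cases hxy : x = y
    · have hzw : w ≠ z := fun h => h1 ⟨hxy, h.symm⟩
      refine key _ (hphase z x y z w) ?_
      subst hxy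
      by_cases hx : x = z <;> simp [hx, hzw, Complex.ext_iff]
    · by_cases hxz : x = z
      · have hyw : w ≠ y := fun h => h2 ⟨hxz, h.symm⟩
        refine key _ (hphase y x y z w) ?_
        subst hxz
        by_cases hx : x = y <;> simp [hx, hyw, Complex.ext_iff]
      · refine key _ (hphase x x y z w) ?_
        by_cases hw : w = x <;> simp [Ne.symm hxy, Ne.symm hxz, hw, Complex.ext_iff]
        all_goals norm_num
  -- Permutation matrices reduce the surviving entries to three values: `W s s s s`, `W s s t t` and
  -- `W s t s t`.
  have hperm : ∀ (π : Equiv.Perm ι) (x y z w : ι), W x y z w = W (π x) (π y) (π z) (π w) := by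
    intro π x y z w
    have hV : (Matrix.of fun i j => if i = π j then (1 : ℂ) else 0) ∈ unitaryGroup ι ℂ := by
      rw [mem_unitaryGroup_iff']
      ext i j
      simp [Matrix.mul_apply, Matrix.one_apply, eq_comm]
    have h := hW _ hV x y z w
    simpa [apply_ite star, ite_mul, mul_ite, Finset.sum_ite_eq] using h
  obtain ⟨s, t, hst⟩ := exists_pair_ne ι
  have htrans : ∀ x z : ι, x ≠ z → ∃ π : Equiv.Perm ι, π s = x ∧ π t = z := by
    intro x z hxz
    refine ⟨(Equiv.swap s x).trans (Equiv.swap (Equiv.swap s x t) z), ?_, ?_⟩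
    · have h1 : x ≠ Equiv.swap s x t := by
        intro h
        apply hst
        have := congrArg (Equiv.swap s x) h
        simpa using this
      simp [Equiv.swap_apply_of_ne_of_ne h1 hxz]
    · simp
  -- The remaining relation needs a unitary that mixes `s` and `t`. The reflection gives `625 W =
  -- (81 + 256) W + 2 · 9 · 16 (W' + W'')` for the three values, and `625 - 337 = 2 · 9 · 16`.
  have hc : W s s s s = W s s t t + W s t s t := by
    have hts := Ne.symm hst
    have hsum : ∀ f : ι → ℂ, ∑ i, pythagoreanReflection s t i s * f i =
        3 / 5 * f s - 4 / 5 * f t := by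
      intro f
      simp_rw [pythagoreanReflection_apply_left hst, add_mul, ite_mul, zero_mul,
        Finset.sum_add_distrib]
      simp; ring
    have h := hW _ (pythagoreanReflection_mem_unitaryGroup hst) s s s s
    simp only [star_pythagoreanReflection_apply, mul_assoc, ← Finset.mul_sum, hsum] at h
    rw [hzero s s s t (by simp [hst]) (by simp [hst]),
      hzero s s t s (by simp [hts]) (by simp [hst]),
      hzero s t s s (by simp [hst]) (by simp [hts]), hzero t s s s (by simp [hts]) (by simp [hts]),
      hzero t t t s (by simp [hts]) (by simp [hts]), hzero t t s t (by simp [hst]) (by simp [hts]),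
      hzero t s t t (by simp [hts]) (by simp [hst]), hzero s t t t (by simp [hst]) (by simp [hst]),
      hzero s t t s (by simp [hst]) (by simp [hst]), hzero t s s t (by simp [hts]) (by simp [hts]),
      show W t t t t = W s s s s by simpa using hperm (Equiv.swap s t) t t t t,
      show W t t s s = W s s t t by simpa using hperm (Equiv.swap s t) t t s s,
      show W t s t s = W s t s t by simpa using hperm (Equiv.swap s t) t s t s] at h
    linear_combination (25 * 25 / (2 * 9 * 16)) * h
  refine ⟨W s s t t, W s t s t, fun x y z w => ?_⟩
  by_cases h1 : x = y ∧ z = w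
  · obtain ⟨rfl, rfl⟩ := h1
    by_cases hxz : x = z
    · subst hxz
      have := hperm (Equiv.swap s x) s s s s
      simp only [Equiv.swap_apply_left] at this
      simp [← this, hc]
    · obtain ⟨π, rfl, rfl⟩ := htrans x z hxz
      rw [← hperm]; simp [hst]
  · by_cases h2 : x = z ∧ y = w
    · obtain ⟨rfl, rfl⟩ := h2
      have hxy : x ≠ y := fun h => h1 ⟨h, h⟩
      obtain ⟨π, rfl, rfl⟩ := htrans x y hxy
      rw [← hperm]; simp [hst]
    · simp [h1, h2, hzero x y z w h1 h2]

end InvariantTensor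

namespace NoisyConv

/-! ### Haar moments -/

/-- A right translate of the left-invariant probability measure is again one, so uniqueness of Haar
measure applies. -/
instance haarGate_isMulRightInvariant (q : ℕ) : (haarGate q).IsMulRightInvariant where
  map_mul_right_eq_self g := by
    have h1 : (haarGate q).IsHaarMeasure := by unfold haarGate; infer_instance
    have : IsProbabilityMeasure ((haarGate q).map (· * g)) :=
      Measure.isProbabilityMeasure_map (by fun_prop)
    exact Measure.isHaarMeasure_eq_of_isProbabilityMeasure _ _

instance gateSecondCountable (q : ℕ) : SecondCountableTopology (Gate q) := by
  have : SecondCountableTopology (Matrix (Fin q × Fin q) (Fin q × Fin q) ℂ) :=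
    inferInstanceAs (SecondCountableTopology (Fin q × Fin q → Fin q × Fin q → ℂ))
  exact TopologicalSpace.Subtype.secondCountableTopology _

/-- The matrix of a gate. -/
abbrev gateMatrix {q : ℕ} (V : Gate q) : Matrix (Fin q × Fin q) (Fin q × Fin q) ℂ := V

theorem integrable_of_continuous_gate {q : ℕ} {f : Gate q → ℂ} (hf : Continuous f) :
    Integrable f (haarGate q) :=
  hf.integrable_of_hasCompactSupport (HasCompactSupport.of_compactSpace f)

theorem continuous_gateMatrix {q : ℕ} : Continuous (gateMatrix (q := q)) := continuous_subtype_val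

/-- The operator `A` conjugated by the inverse of a gate. -/
noncomputable def gateConj {q : ℕ} (A : Matrix (Fin q × Fin q) (Fin q × Fin q) ℂ) (V : Gate q) :
    Matrix (Fin q × Fin q) (Fin q × Fin q) ℂ :=
  (gateMatrix V)ᴴ * A * gateMatrix V

theorem gateMatrix_mul_conjTranspose {q : ℕ} (V : Gate q) :
    gateMatrix V * (gateMatrix V)ᴴ = 1 :=
  Matrix.mem_unitaryGroup_iff.mp V.2

theorem continuous_gateConj {q : ℕ} (A : Matrix (Fin q × Fin q) (Fin q × Fin q) ℂ) :
    Continuous (gateConj A) :=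
  (continuous_gateMatrix.matrix_conjTranspose.mul continuous_const).mul continuous_gateMatrix

theorem trace_gateConj {q : ℕ} (A : Matrix (Fin q × Fin q) (Fin q × Fin q) ℂ) (V : Gate q) :
    (gateConj A V).trace = A.trace := by
  rw [gateConj, Matrix.trace_mul_comm, ← Matrix.mul_assoc, gateMatrix_mul_conjTranspose, one_mul]

theorem gateConj_mul_conjTranspose {q : ℕ} (A B : Matrix (Fin q × Fin q) (Fin q × Fin q) ℂ)
    (V : Gate q) : gateConj A V * (gateConj B V)ᴴ = gateConj (A * Bᴴ) V := by
  simp only [gateConj, Matrix.conjTranspose_mul, Matrix.conjTranspose_conjTranspose,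
    ← Matrix.mul_assoc]
  rw [Matrix.mul_assoc _ (gateMatrix V) (gateMatrix V)ᴴ, gateMatrix_mul_conjTranspose, mul_one]

theorem gateConj_mul_apply {q : ℕ} (A : Matrix (Fin q × Fin q) (Fin q × Fin q) ℂ)
    (U V : Gate q) (x y : Fin q × Fin q) :
    gateConj A (U * V) x y = ∑ x', ∑ y',
      star (gateMatrix V x' x) * gateMatrix V y' y * gateConj A U x' y' := by
  have : gateConj A (U * V) = (gateMatrix V)ᴴ * (gateConj A U * gateMatrix V) := by
    simp only [gateConj, gateMatrix, Submonoid.coe_mul, Matrix.conjTranspose_mul, Matrix.mul_assoc]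
  rw [this, Matrix.mul_apply]
  simp only [Matrix.mul_apply, Matrix.conjTranspose_apply, Finset.mul_sum]
  exact Finset.sum_congr rfl fun _ _ => Finset.sum_congr rfl fun _ _ => by ring

/-- The twirl of the pair `A, B`. -/
noncomputable def twirl {q : ℕ} (A B : Matrix (Fin q × Fin q) (Fin q × Fin q) ℂ)
    (x y z w : Fin q × Fin q) : ℂ :=
  ∫ V : Gate q, gateConj A V x y * star (gateConj B V z w) ∂haarGate q

theorem integrable_twirl {q : ℕ} (A B : Matrix (Fin q × Fin q) (Fin q × Fin q) ℂ)
    (x y z w : Fin q × Fin q) :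
    Integrable (fun V => gateConj A V x y * star (gateConj B V z w)) (haarGate q) :=
  integrable_of_continuous_gate (((continuous_gateConj A).matrix_elem x y).mul
    (continuous_star.comp ((continuous_gateConj B).matrix_elem z w)))

/-- Substituting `U ↦ UV` in the integral conjugates both factors by `V`; this is the hypothesis of
`exists_eq_of_unitary_invariant`. -/
theorem twirl_invariant {q : ℕ} (A B : Matrix (Fin q × Fin q) (Fin q × Fin q) ℂ) (V : Gate q)
    (x y z w : Fin q × Fin q) :
    twirl A B x y z w = ∑ x', ∑ y', ∑ z', ∑ w', star (gateMatrix V x' x) * gateMatrix V y' y *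
      gateMatrix V z' z * star (gateMatrix V w' w) * twirl A B x' y' z' w' := by
  have h : ∀ U : Gate q, gateConj A (U * V) x y * star (gateConj B (U * V) z w) =
      ∑ x', ∑ y', ∑ z', ∑ w', star (gateMatrix V x' x) * gateMatrix V y' y *
      gateMatrix V z' z * star (gateMatrix V w' w) *
        (gateConj A U x' y' * star (gateConj B U z' w')) := by
    intro U
    rw [gateConj_mul_apply, gateConj_mul_apply, star_sum, Finset.sum_mul]
    refine Finset.sum_congr rfl fun x' _ => ?_
    rw [Finset.sum_mul]
    refine Finset.sum_congr rfl fun y' _ => ?_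
    rw [Finset.mul_sum]
    refine Finset.sum_congr rfl fun z' _ => ?_
    rw [star_sum, Finset.mul_sum]
    refine Finset.sum_congr rfl fun w' _ => ?_
    simp only [star_mul', star_star]
    ring
  have hint := integrable_twirl A B
  rw [twirl, ← integral_mul_right_eq_self _ V]
  simp only [h]
  rw [integral_finsetSum Finset.univ (fun _ _ => integrable_finsetSum _ fun _ _ =>
      integrable_finsetSum _ fun _ _ => integrable_finsetSum _ fun _ _ =>
        (hint _ _ _ _).const_mul _)]
  refine Finset.sum_congr rfl fun x' _ => ?_
  rw [integral_finsetSum Finset.univ (fun _ _ => integrable_finsetSum _ fun _ _ =>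
      integrable_finsetSum _ fun _ _ => (hint _ _ _ _).const_mul _)]
  refine Finset.sum_congr rfl fun y' _ => ?_
  rw [integral_finsetSum Finset.univ (fun _ _ => integrable_finsetSum _ fun _ _ =>
     (hint _ _ _ _).const_mul _)]
  refine Finset.sum_congr rfl fun z' _ => ?_
  rw [integral_finsetSum Finset.univ (fun _ _ => (hint _ _ _ _).const_mul _)]
  exact Finset.sum_congr rfl fun w' _ => integral_const_mul _ _

/-- Contracting along a pairing gives a quantity that does not depend on the gate, so nothing is
left to integrate. The same holds for `sum_twirl_cross`. -/
theorem sum_twirl_diag {q : ℕ} (A B : Matrix (Fin q × Fin q) (Fin q × Fin q) ℂ) :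
    ∑ x, ∑ z, twirl A B x x z z = A.trace * star B.trace := by
  have h : ∀ U : Gate q, ∑ x, ∑ z, gateConj A U x x * star (gateConj B U z z) =
      A.trace * star B.trace := by
    intro U
    rw [← trace_gateConj A U, ← trace_gateConj B U, Matrix.trace, Matrix.trace, star_sum,
      Finset.sum_mul_sum]
    rfl
  simp only [twirl, ← integral_finsetSum Finset.univ (fun _ _ => integrable_twirl A B _ _ _ _)]
  rw [← integral_finsetSum Finset.univ (fun _ _ =>
    integrable_finsetSum _ fun _ _ => integrable_twirl A B _ _ _ _)]
  simp only [h]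
  simp

theorem sum_twirl_cross {q : ℕ} (A B : Matrix (Fin q × Fin q) (Fin q × Fin q) ℂ) :
    ∑ x, ∑ y, twirl A B x y x y = (A * Bᴴ).trace := by
  have h : ∀ U : Gate q, ∑ x, ∑ y, gateConj A U x y * star (gateConj B U x y) =
      (A * Bᴴ).trace := by
    intro U
    rw [← trace_gateConj (A * Bᴴ) U, ← gateConj_mul_conjTranspose, Matrix.trace]
    refine Finset.sum_congr rfl fun x _ => ?_
    simp only [Matrix.diag_apply, Matrix.mul_apply, Matrix.conjTranspose_apply]
  simp only [twirl, ← integral_finsetSum Finset.univ (fun _ _ => integrable_twirl A B _ _ _ _)]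
  rw [← integral_finsetSum Finset.univ (fun _ _ =>
    integrable_finsetSum _ fun _ _ => integrable_twirl A B _ _ _ _)]
  simp only [h]
  simp

/-- The twirl of the pair `A, B` is determined by its two traces. -/
theorem twirl_eq {q : ℕ} (hq : 2 ≤ q)
    (A B : Matrix (Fin q × Fin q) (Fin q × Fin q) ℂ) (x y z w : Fin q × Fin q) :
    twirl A B x y z w =
      ((q : ℂ) ^ 2 * (A.trace * star B.trace) - (A * Bᴴ).trace) /
          ((q : ℂ) ^ 2 * ((q : ℂ) ^ 4 - 1)) * (if x = y ∧ z = w then 1 else 0) +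
      ((q : ℂ) ^ 2 * (A * Bᴴ).trace - A.trace * star B.trace) /
          ((q : ℂ) ^ 2 * ((q : ℂ) ^ 4 - 1)) * (if x = z ∧ y = w then 1 else 0) := by
  have : Nontrivial (Fin q × Fin q) := by
    have : Nontrivial (Fin q) := Fin.nontrivial_iff_two_le.mpr hq
    have : Nonempty (Fin q) := inferInstance
    infer_instance
  obtain ⟨a, b, hab⟩ := exists_eq_of_unitary_invariant (twirl A B)
    fun V hV => twirl_invariant A B ⟨V, hV⟩
  -- The two contractions give a linear system for `a, b` with determinant `q⁴(q⁴ - 1)`, nonzero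
  -- since `q ≥ 2`.
  have hp : A.trace * star B.trace = a * ((q : ℂ) ^ 2 * (q : ℂ) ^ 2) + b * (q : ℂ) ^ 2 := by
    rw [← sum_twirl_diag]
    simp only [hab, Finset.sum_add_distrib, ← Finset.mul_sum]
    simp
    ring
  have hr : (A * Bᴴ).trace = a * (q : ℂ) ^ 2 + b * ((q : ℂ) ^ 2 * (q : ℂ) ^ 2) := by
    rw [← sum_twirl_cross]
    simp only [hab, Finset.sum_add_distrib, ← Finset.mul_sum]
    simp
    ring
  have hq0 : (q : ℂ) ≠ 0 := by norm_cast; omega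
  have hq4 : (q : ℂ) ^ 4 - 1 ≠ 0 := by
    rw [sub_ne_zero]; norm_cast
    exact (Nat.one_lt_pow (by norm_num) hq).ne'
  rw [hab x y z w, hp, hr]
  congr 2 <;> field_simp <;> ring

/-- The first moment of the Haar measure. -/
theorem integral_gate_mul_star {q : ℕ} (hq : 2 ≤ q) (x y z w : Fin q × Fin q) :
    ∫ V : Gate q, gateMatrix V x y * star (gateMatrix V z w) ∂haarGate q =
      1 / (q : ℂ) ^ 2 * (if x = z ∧ y = w then 1 else 0) := by
  -- With `B = 1` the second factor is constantly `1`, and the entry `(w, y)` of a conjugated matrix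
  -- unit is a product of one entry of `V` and one conjugate entry.
  have h := twirl_eq hq (Matrix.single z x 1) 1 w y y y
  have h1 : ∀ V : Gate q, gateConj (Matrix.single z x 1) V w y =
      gateMatrix V x y * star (gateMatrix V z w) := by
    intro V
    simp [gateConj, Matrix.mul_apply, Matrix.single_apply, ite_and, mul_comm]
  have h2 : ∀ V : Gate q, gateConj 1 V = 1 := by
    intro V
    rw [gateConj, mul_one]
    exact Matrix.mem_unitaryGroup_iff'.mp V.2
  have hq0 : (q : ℂ) ≠ 0 := by norm_cast; omega
  have hq4 : (q : ℂ) ^ 4 - 1 ≠ 0 := by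
    rw [sub_ne_zero]; norm_cast
    exact (Nat.one_lt_pow (by norm_num) hq).ne'
  simp only [twirl, h1, h2, Matrix.one_apply_eq, star_one, mul_one, Matrix.conjTranspose_one,
    Matrix.trace_one] at h
  rw [h]
  by_cases hzx : x = z
  · subst hzx
    rw [Matrix.trace_single_eq_same]
    by_cases hyw : y = w
    · subst hyw
      simp
      field_simp
      ring
    · have : w ≠ y := Ne.symm hyw
      simp [this, hyw]
  · have : z ≠ x := Ne.symm hzx
    simp [Matrix.trace_single_eq_of_ne _ _ _ this, hzx]

/-! ### Local operators on the register -/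

section Register

open scoped Kronecker

variable {n q : ℕ}

theorem sum_agree_off_one {R : Type*} [AddCommMonoid R] (s : Fin n) (x : Fin n → Fin q)
    (f : (Fin n → Fin q) → R) :
    ∑ z, (if ∀ m, m ≠ s → x m = z m then f z else 0) = ∑ c, f (Function.update x s c) := by
  rw [← Finset.sum_filter]
  refine Finset.sum_nbij' (fun z => z s) (fun c => Function.update x s c) ?_ ?_ ?_ ?_ ?_
  · simp
  · intro c _
    simp only [Finset.mem_filter, Finset.mem_univ, true_and]
    intro m hm
    simp [hm]
  · intro z hz
    simp only [Finset.mem_filter, Finset.mem_univ, true_and] at hz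
    ext m
    by_cases h : m = s
    · subst h; simp
    · simp [h, hz m h]
  · simp
  · intro z hz
    simp only [Finset.mem_filter, Finset.mem_univ, true_and] at hz
    congr 1
    ext m
    by_cases h : m = s
    · subst h; simp
    · simp [h, hz m h]

theorem onQudit_mul_apply (s : Fin n) (A : Matrix (Fin q) (Fin q) ℂ) (X : Op n q)
    (x y : Fin n → Fin q) :
    (onQudit s A * X) x y = ∑ c, A (x s) c * X (Function.update x s c) y := by
  rw [Matrix.mul_apply]
  simp only [onQudit, Matrix.of_apply, ite_mul, zero_mul]
  rw [sum_agree_off_one s x (fun z => A (x s) (z s) * X z y)]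
  simp

theorem onQudit_conjTranspose (s : Fin n) (A : Matrix (Fin q) (Fin q) ℂ) :
    (onQudit s A : Op n q)ᴴ = onQudit s Aᴴ := by
  ext x y
  simp only [onQudit, Matrix.conjTranspose_apply, Matrix.of_apply, apply_ite star, star_zero]
  exact if_congr (forall_congr' fun m => by rw [eq_comm]) rfl rfl

theorem onQudit_one (s : Fin n) : (onQudit s 1 : Op n q) = 1 := by
  ext x y
  simp only [onQudit, Matrix.of_apply, Matrix.one_apply, ← ite_and]
  refine if_congr ⟨fun h => funext fun m => ?_, fun h => by simp [h]⟩ rfl rfl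
  by_cases hm : m = s
  · rw [hm, h.2]
  · exact h.1 m hm

theorem onQudit_mul (s : Fin n) (A B : Matrix (Fin q) (Fin q) ℂ) :
    (onQudit s A * onQudit s B : Op n q) = onQudit s (A * B) := by
  ext x y
  rw [onQudit_mul_apply]
  have h : ∀ c, (∀ m, m ≠ s → Function.update x s c m = y m) ↔ ∀ m, m ≠ s → x m = y m := by
    intro c
    exact forall_congr' fun m => imp_congr_right fun hm => by simp [hm]
  simp only [onQudit, Matrix.of_apply, h, Function.update_self, Matrix.mul_apply]
  split_ifs <;> simp

theorem onQudit_comm {s t : Fin n} (hst : s ≠ t) (A B : Matrix (Fin q) (Fin q) ℂ) :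
    (onQudit s A * onQudit t B : Op n q) = onQudit t B * onQudit s A := by
  rw [← Matrix.mul_one (onQudit t B), ← Matrix.mul_one (onQudit s A)]
  ext x y
  simp only [Matrix.mul_assoc, onQudit_mul_apply, Matrix.one_mul, Finset.mul_sum]
  rw [Finset.sum_comm]
  refine Finset.sum_congr rfl fun c _ => Finset.sum_congr rfl fun d _ => ?_
  rw [Function.update_comm hst, Function.update_of_ne hst, Function.update_of_ne hst.symm]
  ring

theorem onQudit_sum {κ : Type*} (I : Finset κ) (s : Fin n) (A : κ → Matrix (Fin q) (Fin q) ℂ) :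
    (onQudit s (∑ k ∈ I, A k) : Op n q) = ∑ k ∈ I, onQudit s (A k) := by
  ext x y
  simp only [onQudit, Matrix.of_apply, Matrix.sum_apply]
  split_ifs <;> simp

theorem onQudit_smul (s : Fin n) (c : ℂ) (A : Matrix (Fin q) (Fin q) ℂ) :
    (onQudit s (c • A) : Op n q) = c • onQudit s A := by
  ext x y
  simp [onQudit]

/-- With `onPair_eq_sum` this reduces statements about pair operators to products of one-qudit
operators. -/
theorem onPair_kronecker {s t : Fin n} (hst : s ≠ t) (A B : Matrix (Fin q) (Fin q) ℂ) :
    (onPair s t (A ⊗ₖ B) : Op n q) = onQudit s A * onQudit t B := by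
  ext x y
  rw [onQudit_mul_apply]
  simp only [onQudit, onPair, Matrix.of_apply, Matrix.kroneckerMap_apply, mul_ite, mul_zero]
  have h : ∀ c, (∀ m, m ≠ t → Function.update x s c m = y m) ↔
      c = y s ∧ ∀ m, m ≠ s → m ≠ t → x m = y m := by
    intro c
    constructor
    · intro h
      refine ⟨by simpa using h s hst, fun m h1 h2 => by simpa [h1] using h m h2⟩
    · rintro ⟨rfl, h⟩ m hm
      by_cases h1 : m = s
      · subst h1; simp
      · simpa [h1] using h m h1 hm
  simp only [h, ite_and, Finset.sum_ite_eq', Finset.mem_univ, if_true,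
    Function.update_of_ne hst.symm]

theorem onPair_eq_sum (s t : Fin n) (A : Matrix (Fin q × Fin q) (Fin q × Fin q) ℂ) :
    (onPair s t A : Op n q) = ∑ p, ∑ p', A p p' • onPair s t (Matrix.single p p' 1) := by
  ext x y
  simp only [onPair, Matrix.of_apply, Matrix.sum_apply, Matrix.smul_apply, Matrix.single_apply]
  split_ifs
  · simp [ite_and]
  · simp

theorem onPair_single {s t : Fin n} (hst : s ≠ t) (p p' : Fin q × Fin q) :
    (onPair s t (Matrix.single p p' 1) : Op n q) =
      onQudit s (Matrix.single p.1 p'.1 1) * onQudit t (Matrix.single p.2 p'.2 1) := by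
  rw [← onPair_kronecker hst, Matrix.single_kronecker_single]
  simp

theorem onPair_conjTranspose (s t : Fin n) (A : Matrix (Fin q × Fin q) (Fin q × Fin q) ℂ) :
    (onPair s t A : Op n q)ᴴ = onPair s t Aᴴ := by
  ext x y
  simp only [onPair, Matrix.conjTranspose_apply, Matrix.of_apply, apply_ite star, star_zero]
  exact if_congr (forall_congr' fun m => by rw [eq_comm]) rfl rfl

theorem onPair_mul {s t : Fin n} (hst : s ≠ t)
    (A B : Matrix (Fin q × Fin q) (Fin q × Fin q) ℂ) :
    (onPair s t A * onPair s t B : Op n q) = onPair s t (A * B) := by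
  ext x y
  rw [Matrix.mul_apply]
  have h1 : ∀ z, (onPair s t A : Op n q) x z * onPair s t B z y =
      ∑ p : Fin q × Fin q, if Function.update (Function.update x s p.1) t p.2 = z then
        A (x s, x t) p * onPair s t B z y else 0 := by
    intro z
    have h2 : ∀ p : Fin q × Fin q, Function.update (Function.update x s p.1) t p.2 = z ↔
        p = (z s, z t) ∧ ∀ m, m ≠ s → m ≠ t → x m = z m := by
      intro p
      constructor
      · rintro rfl
        exact ⟨by simp [hst], fun m h1 h2 => by simp [h1, h2]⟩
      · rintro ⟨rfl, h⟩
        ext m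
        by_cases hm : m = t
        · subst hm; simp
        · by_cases hm' : m = s
          · subst hm'; simp [hm]
          · simp [hm, hm', h m hm' hm]
    simp only [h2, ite_and, Finset.sum_ite_eq', Finset.mem_univ, if_true]
    simp only [onPair, Matrix.of_apply, mul_ite, ite_mul, mul_zero, zero_mul]
    split_ifs <;> rfl
  simp only [h1]
  rw [Finset.sum_comm]
  simp only [Finset.sum_ite_eq, Finset.mem_univ, if_true]
  have h3 : ∀ p : Fin q × Fin q,
      (∀ m, m ≠ s → m ≠ t → Function.update (Function.update x s p.1) t p.2 m = y m) ↔
        ∀ m, m ≠ s → m ≠ t → x m = y m := fun p =>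
    forall_congr' fun m => imp_congr_right fun h1 => imp_congr_right fun h2 => by simp [h1, h2]
  simp only [onPair, Matrix.of_apply, h3, Function.update_self, Function.update_of_ne hst,
    Matrix.mul_apply, Prod.mk.eta]
  split_ifs <;> simp

theorem onPair_comm_onQudit {s t u : Fin n} (hst : s ≠ t) (hs : s ≠ u) (ht : t ≠ u)
    (A : Matrix (Fin q × Fin q) (Fin q × Fin q) ℂ) (B : Matrix (Fin q) (Fin q) ℂ) :
    (onPair s t A * onQudit u B : Op n q) = onQudit u B * onPair s t A := by
  rw [onPair_eq_sum]
  simp only [Finset.sum_mul, Finset.mul_sum, Matrix.smul_mul, Matrix.mul_smul, onPair_single hst]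
  refine Finset.sum_congr rfl fun p _ => Finset.sum_congr rfl fun p' _ => ?_
  rw [Matrix.mul_assoc, onQudit_comm ht, ← Matrix.mul_assoc, onQudit_comm hs, Matrix.mul_assoc]

end Register

/-! ### Readout projectors -/

section Readout

variable {n q : ℕ}

/-- The projector `|0⟩⟨0|` on one qudit. -/
noncomputable def zeroMat (q : ℕ) : Matrix (Fin q) (Fin q) ℂ :=
  Matrix.diagonal fun c => if (c : ℕ) = 0 then 1 else 0

open Classical in
/-- The projector onto `|0⟩` on all qudits whose number satisfies `S`. -/
noncomputable def readProj (n q : ℕ) (S : ℕ → Prop) : Op n q :=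
  Matrix.diagonal fun x => if ∀ m : Fin n, S (m + 1) → (x m : ℕ) = 0 then 1 else 0

theorem zeroProj_eq_readProj (i : ℕ) : zeroProj n q i = readProj n q (fun m => m = i) := by
  unfold zeroProj readProj
  congr! 3

theorem readProj_mul (S T : ℕ → Prop) :
    readProj n q S * readProj n q T = readProj n q (fun m => S m ∨ T m) := by
  classical
  unfold readProj
  rw [Matrix.diagonal_mul_diagonal]
  congr 1
  ext x
  by_cases h1 : ∀ m : Fin n, S (m + 1) → (x m : ℕ) = 0
  · by_cases h2 : ∀ m : Fin n, T (m + 1) → (x m : ℕ) = 0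
    · rw [if_pos h1, if_pos h2, if_pos fun m hm => hm.elim (h1 m) (h2 m), one_mul]
    · rw [if_neg h2, mul_zero, if_neg]
      exact fun h => h2 fun m hm => h m (.inr hm)
  · rw [if_neg h1, zero_mul, if_neg]
    exact fun h => h1 fun m hm => h m (.inl hm)

theorem readProj_of_forall_not {S : ℕ → Prop} (hS : ∀ m : Fin n, ¬ S (m + 1)) :
    readProj n q S = 1 := by
  unfold readProj
  simp [hS]

theorem readProj_comm_onQudit {S : ℕ → Prop} {t : Fin n} (ht : ¬ S (t + 1))
    (A : Matrix (Fin q) (Fin q) ℂ) :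
    readProj n q S * onQudit t A = onQudit t A * readProj n q S := by
  classical
  ext x y
  rw [readProj, Matrix.diagonal_mul, Matrix.mul_diagonal, mul_comm]
  simp only [onQudit, Matrix.of_apply]
  split_ifs with h1 h2 h3 h3
  · rfl
  · refine absurd (fun m hm => ?_) h3
    rw [← h1 m (fun h => ht (h ▸ hm))]
    exact h2 m hm
  · refine absurd (fun m hm => ?_) h2
    rw [h1 m (fun h => ht (h ▸ hm))]
    exact h3 m hm
  · rfl
  all_goals simp

theorem onQudit_zeroMat (t : Fin n) :
    onQudit t (zeroMat q) = readProj n q (fun m => m = t + 1) := by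
  classical
  ext x y
  simp only [onQudit, zeroMat, readProj, Matrix.of_apply, Matrix.diagonal_apply]
  by_cases hxy : x = y
  · subst hxy
    by_cases h : (x t : ℕ) = 0
    · simp only [implies_true, h, if_true]
      rw [if_pos]
      intro m hm
      rw [show m = t from Fin.ext (by omega), h]
    · simp only [implies_true, h, if_true, if_false]
      rw [if_neg]
      exact fun h' => h (h' t rfl)
  · rw [if_neg hxy, ite_eq_right_iff]
    intro h1
    rw [if_neg]
    intro h2
    refine hxy (funext fun m => ?_)
    by_cases hm : m = t
    · rw [hm, h2]
    · exact h1 m hm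

/-- Every qudit starts in `|0⟩`, so a readout projector costs nothing on an untouched qudit. -/
theorem readProj_mul_initialState (S : ℕ → Prop) :
    readProj n q S * initialState n q = initialState n q := by
  classical
  ext x y
  rw [readProj, Matrix.diagonal_mul]
  simp only [initialState, Matrix.of_apply]
  split_ifs with h1 h2 h2
  · simp
  · simp
  · exact absurd (fun m _ => h2.1 m) h1
  · simp

theorem trace_initialState (hq : 0 < q) : (initialState n q).trace = 1 := by
  have : NeZero q := ⟨hq.ne'⟩
  rw [Matrix.trace, Finset.sum_eq_single (fun _ => (0 : Fin q))]
  · simp [initialState]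
  · intro x _ hx
    simp only [initialState, Matrix.diag_apply, Matrix.of_apply, and_self]
    rw [if_neg]
    intro h
    exact hx (funext fun m => Fin.ext (by simpa using h m))
  · simp

end Readout

/-! ### Kraus maps on the register -/

section Kraus

open scoped Kronecker

variable {n q : ℕ} {κ κ' : Type*} [Fintype κ] [Fintype κ']

/-- The map `X ↦ A X A†`. -/
noncomputable def conjMap (A : Op n q) : Op n q →ₗ[ℂ] Op n q where
  toFun X := A * X * Aᴴ
  map_add' X Y := by rw [Matrix.mul_add, Matrix.add_mul]
  map_smul' c X := by rw [Matrix.mul_smul, Matrix.smul_mul, RingHom.id_apply]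

theorem conjMap_apply (A X : Op n q) : conjMap A X = A * X * Aᴴ := rfl

/-- The completely positive map with Kraus operators `K`. -/
noncomputable def krausMap (K : κ → Op n q) : Op n q →ₗ[ℂ] Op n q := ∑ k, conjMap (K k)

theorem krausMap_apply (K : κ → Op n q) (X : Op n q) :
    krausMap K X = ∑ k, K k * X * (K k)ᴴ := by
  simp [krausMap, conjMap_apply]

/-- The completely positive map with Kraus operators `K` on qudit `s`. -/
noncomputable def krausOn (s : Fin n) (K : κ → Matrix (Fin q) (Fin q) ℂ) :
    Op n q →ₗ[ℂ] Op n q :=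
  krausMap fun k => onQudit s (K k)

/-- The completely depolarising family of all matrix units. -/
noncomputable def unitFamily (q : ℕ) (p : Fin q × Fin q) : Matrix (Fin q) (Fin q) ℂ :=
  Matrix.single p.1 p.2 1

theorem noiseOn_eq (E : Noise q) (s : Fin n) (X : Op n q) :
    noiseOn E s X = krausOn s E.kraus X := by
  rw [krausOn, krausMap_apply, noiseOn]

theorem krausMap_comp (K : κ → Op n q) (K' : κ' → Op n q) (X : Op n q) :
    krausMap K (krausMap K' X) = krausMap (fun p : κ × κ' => K p.1 * K' p.2) X := by
  simp only [krausMap_apply, Finset.mul_sum, Finset.sum_mul, Fintype.sum_prod_type,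
    Matrix.conjTranspose_mul, Matrix.mul_assoc]

theorem krausOn_comp (s : Fin n) (K : κ → Matrix (Fin q) (Fin q) ℂ)
    (K' : κ' → Matrix (Fin q) (Fin q) ℂ) (X : Op n q) :
    krausOn s K (krausOn s K' X) = krausOn s (fun p : κ × κ' => K p.1 * K' p.2) X := by
  simp only [krausOn, krausMap_comp, onQudit_mul]

theorem krausOn_comp_krausOn {s t : Fin n} (hst : s ≠ t) (K : κ → Matrix (Fin q) (Fin q) ℂ)
    (K' : κ' → Matrix (Fin q) (Fin q) ℂ) (X : Op n q) :
    krausOn t K (krausOn s K' X) =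
      krausMap (fun p : κ × κ' => onPair s t (K' p.2 ⊗ₖ K p.1)) X := by
  simp only [krausOn, krausMap_comp, onPair_kronecker hst, onQudit_comm hst]

/-- `Φ` acts trivially on qudit `t`. -/
def AwayFrom (t : Fin n) (Φ : Op n q →ₗ[ℂ] Op n q) : Prop :=
  ∀ A X, Φ (onQudit t A * X) = onQudit t A * Φ X ∧ Φ (X * onQudit t A) = Φ X * onQudit t A

theorem AwayFrom.id (t : Fin n) : AwayFrom t (LinearMap.id : Op n q →ₗ[ℂ] Op n q) :=
  fun _ _ => ⟨rfl, rfl⟩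

theorem AwayFrom.comp {t : Fin n} {Φ Ψ : Op n q →ₗ[ℂ] Op n q} (hΦ : AwayFrom t Φ)
    (hΨ : AwayFrom t Ψ) : AwayFrom t (Φ ∘ₗ Ψ) := fun A X =>
  ⟨by simp only [LinearMap.comp_apply, (hΨ A X).1, (hΦ A _).1],
    by simp only [LinearMap.comp_apply, (hΨ A X).2, (hΦ A _).2]⟩

theorem awayFrom_conjMap {t : Fin n} {B : Op n q}
    (hB : ∀ A, B * onQudit t A = onQudit t A * B)
    (hB' : ∀ A, Bᴴ * onQudit t A = onQudit t A * Bᴴ) : AwayFrom t (conjMap B) := fun A X => by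
  constructor
  · rw [conjMap_apply, conjMap_apply, ← Matrix.mul_assoc B, hB]
    simp only [Matrix.mul_assoc]
  · rw [conjMap_apply, conjMap_apply, Matrix.mul_assoc, Matrix.mul_assoc, ← hB']
    simp only [Matrix.mul_assoc]

theorem awayFrom_krausOn {s t : Fin n} (hst : s ≠ t) (K : κ → Matrix (Fin q) (Fin q) ℂ) :
    AwayFrom t (krausOn s K) := by
  have h : ∀ k, AwayFrom t (conjMap (onQudit s (K k))) := fun k =>
    awayFrom_conjMap (fun A => onQudit_comm hst _ _) (fun A => by
      rw [onQudit_conjTranspose, onQudit_comm hst])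
  intro A X
  simp only [krausOn, krausMap, LinearMap.sum_apply, (h _ A X).1, (h _ A X).2, Finset.mul_sum,
    Finset.sum_mul, and_self]

/-- Lets a map on qudit `t` move out of the rewinding of earlier gates until it meets the readout of
`t`. -/
theorem AwayFrom.krausOn_comm {t : Fin n} {Φ : Op n q →ₗ[ℂ] Op n q} (hΦ : AwayFrom t Φ)
    (K : κ → Matrix (Fin q) (Fin q) ℂ) (X : Op n q) :
    Φ (krausOn t K X) = krausOn t K (Φ X) := by
  simp only [krausOn, krausMap_apply, map_sum, onQudit_conjTranspose, (hΦ _ _).1, (hΦ _ _).2]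

/-- The adjoint of a Kraus map on one qudit, applied to an observable of this qudit. -/
theorem trace_mul_krausOn {t : Fin n} {P : Op n q}
    (hP : ∀ A, P * onQudit t A = onQudit t A * P) (K : κ → Matrix (Fin q) (Fin q) ℂ)
    (Q : Matrix (Fin q) (Fin q) ℂ) (X : Op n q) :
    (P * onQudit t Q * krausOn t K X).trace =
      (P * onQudit t (∑ k, (K k)ᴴ * Q * K k) * X).trace := by
  rw [onQudit_sum, Finset.mul_sum, Finset.sum_mul, Matrix.trace_sum, krausOn, krausMap_apply,
    Finset.mul_sum, Matrix.trace_sum]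
  refine Finset.sum_congr rfl fun k _ => ?_
  rw [← Matrix.mul_assoc, Matrix.trace_mul_comm, onQudit_conjTranspose]
  simp only [← onQudit_mul, ← Matrix.mul_assoc, hP]
  rw [Matrix.mul_assoc _ P (onQudit t Q), hP Q, ← Matrix.mul_assoc]

theorem trace_mul_krausOn_of_tracePreserving {t : Fin n} {P : Op n q}
    (hP : ∀ A, P * onQudit t A = onQudit t A * P) {K : κ → Matrix (Fin q) (Fin q) ℂ}
    (hK : ∑ k, (K k)ᴴ * K k = 1) (X : Op n q) :
    (P * krausOn t K X).trace = (P * X).trace := by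
  have h := trace_mul_krausOn hP K 1 X
  simpa [onQudit_one, hK] using h

/-- In the Heisenberg picture too, `D` replaces an observable by its trace times `1`; `D` is not
normalised, and `Q = 1` gives the factor `q`. -/
theorem sum_unitFamily (Q : Matrix (Fin q) (Fin q) ℂ) :
    ∑ p, (unitFamily q p)ᴴ * Q * unitFamily q p = Q.trace • (1 : Matrix (Fin q) (Fin q) ℂ) := by
  ext x y
  simp only [unitFamily, Fintype.sum_prod_type, Matrix.sum_apply, Matrix.smul_apply]
  simp [Matrix.mul_apply, Matrix.single_apply, Matrix.one_apply, ite_and, Matrix.trace, eq_comm]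

theorem trace_mul_krausOn_unitFamily {t : Fin n} {P : Op n q}
    (hP : ∀ A, P * onQudit t A = onQudit t A * P)
    (Q : Matrix (Fin q) (Fin q) ℂ) (X : Op n q) :
    (P * onQudit t Q * krausOn t (unitFamily q) X).trace = Q.trace * (P * X).trace := by
  rw [trace_mul_krausOn hP, sum_unitFamily, onQudit_smul, onQudit_one]
  simp

/-! ### Averages over one gate -/

theorem sum_onPair_single_diag (s t : Fin n) :
    ∑ x, (onPair s t (Matrix.single x x 1) : Op n q) = onPair s t 1 := by
  rw [onPair_eq_sum s t 1]
  simp [Matrix.one_apply, ite_smul]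

/-- Identifies the second index pairing of the twirl with depolarisation of both qudits. -/
theorem sum_onPair_single_conj {s t : Fin n} (hst : s ≠ t) (X : Op n q) :
    ∑ x, ∑ y, onPair s t (Matrix.single x y 1) * X * (onPair s t (Matrix.single x y 1))ᴴ =
      krausOn t (unitFamily q) (krausOn s (unitFamily q) X) := by
  simp only [krausOn_comp_krausOn hst, krausMap_apply, onPair_kronecker hst, onPair_single hst,
    unitFamily, Fintype.sum_prod_type]
  rw [Finset.sum_comm]
  refine Finset.sum_congr rfl fun a _ => ?_
  conv_rhs => rw [Finset.sum_comm]
  refine Finset.sum_congr rfl fun c _ => ?_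
  rw [Finset.sum_comm]

/-- The average over one gate of a Kraus map of a pair of qudits, conjugated by this gate. -/
theorem integral_conj_krausMap (hq : 2 ≤ q) {s t : Fin n} (hst : s ≠ t)
    (K : κ → Matrix (Fin q × Fin q) (Fin q × Fin q) ℂ) (X : Op n q) (φ : Op n q →ₗ[ℂ] ℂ) :
    ∫ V : Gate q, φ (conjMap (onPair s t (gateMatrix V))ᴴ (krausMap (fun k => onPair s t (K k))
      (conjMap (onPair s t (gateMatrix V)) X))) ∂haarGate q =
      ((q : ℂ) ^ 2 * (∑ k, (K k).trace * star (K k).trace) - ∑ k, (K k * (K k)ᴴ).trace) /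
          ((q : ℂ) ^ 2 * ((q : ℂ) ^ 4 - 1)) * φ X +
      ((q : ℂ) ^ 2 * (∑ k, (K k * (K k)ᴴ).trace) - ∑ k, (K k).trace * star (K k).trace) /
          ((q : ℂ) ^ 2 * ((q : ℂ) ^ 4 - 1)) *
        φ (krausOn t (unitFamily q) (krausOn s (unitFamily q) X)) := by
  set e : (Fin q × Fin q) → (Fin q × Fin q) → Op n q :=
    fun x y => onPair s t (Matrix.single x y 1) with he
  have h1 : ∀ V : Gate q, φ (conjMap (onPair s t (gateMatrix V))ᴴ
      (krausMap (fun k => onPair s t (K k)) (conjMap (onPair s t (gateMatrix V)) X))) =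
      ∑ k, ∑ x, ∑ y, ∑ z, ∑ w, gateConj (K k) V x y * star (gateConj (K k) V z w) *
        φ (e x y * X * (e z w)ᴴ) := by
    intro V
    have h2 : conjMap (onPair s t (gateMatrix V))ᴴ
      (krausMap (fun k => onPair s t (K k)) (conjMap (onPair s t (gateMatrix V)) X)) =
      ∑ k, onPair s t (gateConj (K k) V) * X * (onPair s t (gateConj (K k) V))ᴴ := by
      simp only [krausMap_apply, conjMap_apply, gateConj, ← onPair_mul hst, ← onPair_conjTranspose,
        Matrix.conjTranspose_mul, Matrix.conjTranspose_conjTranspose, Finset.mul_sum,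
        Finset.sum_mul, Matrix.mul_assoc]
    rw [h2, map_sum]
    refine Finset.sum_congr rfl fun k _ => ?_
    rw [onPair_eq_sum s t (gateConj (K k) V)]
    simp only [Matrix.conjTranspose_sum, Matrix.conjTranspose_smul, Finset.sum_mul,
      Matrix.smul_mul, map_sum, map_smul, smul_eq_mul]
    refine Finset.sum_congr rfl fun x _ => Finset.sum_congr rfl fun y _ => ?_
    simp only [Matrix.mul_smul, map_sum, map_smul, smul_eq_mul, Finset.mul_sum,
      mul_assoc, he]
  have hint : ∀ k x y z w, Integrable (fun V => gateConj (K k) V x y *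
      star (gateConj (K k) V z w) * φ (e x y * X * (e z w)ᴴ)) (haarGate q) := fun k x y z w =>
    (integrable_twirl _ _ _ _ _ _).mul_const _
  simp only [h1]
  rw [integral_finsetSum _ fun _ _ => integrable_finsetSum _ fun _ _ =>
    integrable_finsetSum _ fun _ _ => integrable_finsetSum _ fun _ _ =>
    integrable_finsetSum _ fun _ _ => hint _ _ _ _ _]
  simp only [Finset.mul_sum, ← Finset.sum_sub_distrib, Finset.sum_div, Finset.sum_mul]
  rw [← Finset.sum_add_distrib]
  refine Finset.sum_congr rfl fun k _ => ?_
  have h3 : ∫ V : Gate q, ∑ x, ∑ y, ∑ z, ∑ w, gateConj (K k) V x y *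
      star (gateConj (K k) V z w) * φ (e x y * X * (e z w)ᴴ) ∂haarGate q =
      ∑ x, ∑ y, ∑ z, ∑ w, twirl (K k) (K k) x y z w * φ (e x y * X * (e z w)ᴴ) := by
    rw [integral_finsetSum _ fun _ _ =>
      integrable_finsetSum _ fun _ _ => integrable_finsetSum _ fun _ _ =>
      integrable_finsetSum _ fun _ _ => hint _ _ _ _ _]
    refine Finset.sum_congr rfl fun x _ => ?_
    rw [integral_finsetSum _ fun _ _ => integrable_finsetSum _ fun _ _ =>
      integrable_finsetSum _ fun _ _ => hint _ _ _ _ _]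
    refine Finset.sum_congr rfl fun y _ => ?_
    rw [integral_finsetSum _ fun _ _ => integrable_finsetSum _ fun _ _ => hint _ _ _ _ _]
    refine Finset.sum_congr rfl fun z _ => ?_
    rw [integral_finsetSum _ fun _ _ => hint _ _ _ _ _]
    exact Finset.sum_congr rfl fun w _ => integral_mul_const _ _
  -- The pairing `x = y, z = w` sums the diagonal matrix units to `1` on each side and returns `X`
  -- itself.
  have h4 : ∑ x, ∑ z, φ (e x x * X * (e z z)ᴴ) = φ X := by
    simp only [← map_sum, ← Matrix.mul_sum, ← Matrix.conjTranspose_sum, ← Matrix.sum_mul]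
    simp only [he, sum_onPair_single_diag]
    rw [← show (onPair s t ((1 : Matrix (Fin q) (Fin q) ℂ) ⊗ₖ (1 : Matrix (Fin q) (Fin q) ℂ)) :
      Op n q) = onPair s t 1 by rw [Matrix.one_kronecker_one], onPair_kronecker hst]
    simp [onQudit_one]
  have h5 : ∑ x, ∑ y, φ (e x y * X * (e x y)ᴴ) =
      φ (krausOn t (unitFamily q) (krausOn s (unitFamily q) X)) := by
    rw [← sum_onPair_single_conj hst]
    simp only [map_sum, he]
  rw [h3, ← h4, ← h5]
  simp only [twirl_eq hq, add_mul, Finset.sum_add_distrib, mul_assoc, ← Finset.mul_sum]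
  simp only [ite_mul, one_mul, zero_mul, ite_and, Finset.sum_ite_irrel, Finset.sum_const_zero,
    Finset.sum_ite_eq, Finset.mem_univ, if_true]

/-- The average over one gate of an operator conjugated by this gate. -/
theorem integral_conjMap_onPair (hq : 2 ≤ q) {s t : Fin n} (hst : s ≠ t)
    (X : Op n q) (φ : Op n q →ₗ[ℂ] ℂ) :
    ∫ V : Gate q, φ (conjMap (onPair s t (gateMatrix V)) X) ∂haarGate q =
      1 / (q : ℂ) ^ 2 * φ (krausOn t (unitFamily q) (krausOn s (unitFamily q) X)) := by
  set e : (Fin q × Fin q) → (Fin q × Fin q) → Op n q :=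
    fun x y => onPair s t (Matrix.single x y 1) with he
  have h1 : ∀ V : Gate q, φ (conjMap (onPair s t (gateMatrix V)) X) =
      ∑ x, ∑ y, ∑ z, ∑ w, gateMatrix V x y * star (gateMatrix V z w) *
        φ (e x y * X * (e z w)ᴴ) := by
    intro V
    rw [conjMap_apply, onPair_eq_sum s t (gateMatrix V)]
    simp only [Matrix.conjTranspose_sum, Matrix.conjTranspose_smul, Finset.sum_mul,
      Matrix.smul_mul, map_sum, map_smul, smul_eq_mul]
    refine Finset.sum_congr rfl fun x _ => Finset.sum_congr rfl fun y _ => ?_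
    simp only [Matrix.mul_smul, map_sum, map_smul, smul_eq_mul, Finset.mul_sum,
      mul_assoc, he]
  have hint : ∀ x y z w, Integrable (fun V => gateMatrix V x y *
      star (gateMatrix V z w) * φ (e x y * X * (e z w)ᴴ)) (haarGate q) := fun x y z w =>
    (integrable_of_continuous_gate ((continuous_gateMatrix.matrix_elem x y).mul
      (continuous_star.comp (continuous_gateMatrix.matrix_elem z w)))).mul_const _
  have h3 : ∫ V : Gate q, ∑ x, ∑ y, ∑ z, ∑ w, gateMatrix V x y *
      star (gateMatrix V z w) * φ (e x y * X * (e z w)ᴴ) ∂haarGate q =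
      ∑ x, ∑ y, ∑ z, ∑ w, 1 / (q : ℂ) ^ 2 * (if x = z ∧ y = w then 1 else 0) *
        φ (e x y * X * (e z w)ᴴ) := by
    rw [integral_finsetSum _ fun _ _ =>
      integrable_finsetSum _ fun _ _ => integrable_finsetSum _ fun _ _ =>
      integrable_finsetSum _ fun _ _ => hint _ _ _ _]
    refine Finset.sum_congr rfl fun x _ => ?_
    rw [integral_finsetSum _ fun _ _ => integrable_finsetSum _ fun _ _ =>
      integrable_finsetSum _ fun _ _ => hint _ _ _ _]
    refine Finset.sum_congr rfl fun y _ => ?_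
    rw [integral_finsetSum _ fun _ _ => integrable_finsetSum _ fun _ _ => hint _ _ _ _]
    refine Finset.sum_congr rfl fun z _ => ?_
    rw [integral_finsetSum _ fun _ _ => hint _ _ _ _]
    refine Finset.sum_congr rfl fun w _ => ?_
    rw [integral_mul_const, integral_gate_mul_star hq]
  have h5 : ∑ x, ∑ y, φ (e x y * X * (e x y)ᴴ) =
      φ (krausOn t (unitFamily q) (krausOn s (unitFamily q) X)) := by
    rw [← sum_onPair_single_conj hst]
    simp only [map_sum, he]
  simp only [h1]
  rw [h3, ← h5]
  simp only [mul_assoc, ← Finset.mul_sum]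
  simp only [ite_mul, one_mul, zero_mul, ite_and, Finset.sum_ite_irrel, Finset.sum_const_zero,
    Finset.sum_ite_eq, Finset.mem_univ, if_true]

end Kraus

/-! ### Trace invariants of Kraus families -/

section TraceInvariants

open scoped Kronecker

variable {q : ℕ} {ι : Type*} [Fintype ι] {κ κ' : Type*} [Fintype κ] [Fintype κ']

/-- The trace of the superoperator with Kraus operators `K`. -/
noncomputable def superTrace (K : κ → Matrix ι ι ℂ) : ℂ := ∑ k, (K k).trace * star (K k).trace

/-- The trace of the image of `1` under the superoperator with Kraus operators `K`. -/
noncomputable def traceOne (K : κ → Matrix ι ι ℂ) : ℂ := ∑ k, (K k * (K k)ᴴ).trace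

theorem superTrace_kronecker (K : κ → Matrix (Fin q) (Fin q) ℂ)
    (K' : κ' → Matrix (Fin q) (Fin q) ℂ) :
    superTrace (fun p : κ × κ' => K' p.2 ⊗ₖ K p.1) = superTrace K' * superTrace K := by
  simp only [superTrace, Matrix.trace_kronecker, Fintype.sum_prod_type, Finset.sum_mul_sum,
    star_mul']
  rw [Finset.sum_comm]
  exact Finset.sum_congr rfl fun _ _ => Finset.sum_congr rfl fun _ _ => by ring

theorem traceOne_kronecker (K : κ → Matrix (Fin q) (Fin q) ℂ)
    (K' : κ' → Matrix (Fin q) (Fin q) ℂ) :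
    traceOne (fun p : κ × κ' => K' p.2 ⊗ₖ K p.1) = traceOne K' * traceOne K := by
  simp only [traceOne, Matrix.conjTranspose_kronecker, ← Matrix.mul_kronecker_mul,
    Matrix.trace_kronecker, Fintype.sum_prod_type, Finset.sum_mul_sum]
  rw [Finset.sum_comm]

/-- By cyclicity only `∑ K†K` of the outer map matters: `c = 1` for a channel, `c = q` for `D`. -/
theorem traceOne_mul {K : κ → Matrix (Fin q) (Fin q) ℂ} {c : ℂ}
    (hK : ∑ k, (K k)ᴴ * K k = c • 1) (K' : κ' → Matrix (Fin q) (Fin q) ℂ) :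
    traceOne (fun p : κ × κ' => K p.1 * K' p.2) = c * traceOne K' := by
  simp only [traceOne, Fintype.sum_prod_type, Matrix.conjTranspose_mul]
  rw [Finset.sum_comm, Finset.mul_sum]
  refine Finset.sum_congr rfl fun l _ => ?_
  have h : ∀ k, (K k * K' l * ((K' l)ᴴ * (K k)ᴴ)).trace =
      ((K k)ᴴ * K k * (K' l * (K' l)ᴴ)).trace := by
    intro k
    rw [← Matrix.mul_assoc, Matrix.trace_mul_comm]
    simp only [Matrix.mul_assoc]
  simp only [h, ← Matrix.trace_sum, ← Matrix.sum_mul, hK]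
  simp

theorem traceOne_noise (E : Noise q) : traceOne E.kraus = q := by
  have : ∀ k, (E.kraus k * (E.kraus k)ᴴ).trace = ((E.kraus k)ᴴ * E.kraus k).trace := fun k =>
    Matrix.trace_mul_comm _ _
  simp only [traceOne, this, ← Matrix.trace_sum, E.sum_conjTranspose_mul]
  simp

theorem superTrace_noise (hq : q ≠ 0) (E : Noise q) :
    superTrace E.kraus = (E.alpha : ℂ) * (q : ℂ) ^ 2 := by
  have hq0 : (q : ℂ) ≠ 0 := by exact_mod_cast hq
  simp only [superTrace, Noise.alpha, Complex.star_def, Complex.mul_conj, Complex.normSq_eq_norm_sq]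
  push_cast
  field_simp

theorem superTrace_noise_noise (hq : q ≠ 0) (E : Noise q) :
    superTrace (fun p : Fin E.rank × Fin E.rank => E.kraus p.1 * E.kraus p.2) =
      (E.beta : ℂ) * (q : ℂ) ^ 2 := by
  have hq0 : (q : ℂ) ≠ 0 := by exact_mod_cast hq
  simp only [superTrace, Noise.beta, Complex.star_def, Complex.mul_conj, Complex.normSq_eq_norm_sq,
    Fintype.sum_prod_type]
  push_cast
  field_simp

/-- Since `D` has rank one, the trace of `Φ ∘ D ∘ Φ` is `Tr Φ(Φ(1))`, which trace preservation makes
`q`. Hence neither parameter of the noise appears. -/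
theorem superTrace_noise_unit_noise (E : Noise q) :
    superTrace (fun p : Fin E.rank × ((Fin q × Fin q) × Fin E.rank) =>
      E.kraus p.1 * (unitFamily q p.2.1 * E.kraus p.2.2)) = q := by
  have h : ∀ k l, ∑ p, (E.kraus k * (unitFamily q p * E.kraus l)).trace *
      star (E.kraus k * (unitFamily q p * E.kraus l)).trace =
      (E.kraus l * E.kraus k * (E.kraus l * E.kraus k)ᴴ).trace := by
    intro k l
    have h1 : ∀ p : Fin q × Fin q, (E.kraus k * (unitFamily q p * E.kraus l)).trace =
        (E.kraus l * E.kraus k) p.2 p.1 := by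
      intro p
      rw [← Matrix.mul_assoc, Matrix.trace_mul_comm, ← Matrix.mul_assoc, unitFamily,
        Matrix.trace_mul_single]
      simp
    simp only [h1, Fintype.sum_prod_type]
    rw [Matrix.trace]
    rw [Finset.sum_comm]
    refine Finset.sum_congr rfl fun x _ => ?_
    rw [Matrix.diag_apply, Matrix.mul_apply]
    rfl
  have h2 := traceOne_mul (c := 1) (K := E.kraus)
    (by rw [one_smul, E.sum_conjTranspose_mul]) E.kraus
  rw [traceOne_noise, one_mul] at h2
  rw [← h2]
  rw [superTrace, traceOne, Fintype.sum_prod_type, Fintype.sum_prod_type]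
  conv_rhs => rw [Finset.sum_comm]
  refine Finset.sum_congr rfl fun k _ => ?_
  rw [Fintype.sum_prod_type, Finset.sum_comm]
  exact Finset.sum_congr rfl fun l _ => h k l

theorem traceOne_noise_noise (E : Noise q) :
    traceOne (fun p : Fin E.rank × Fin E.rank => E.kraus p.1 * E.kraus p.2) = q := by
  rw [traceOne_mul (c := 1) (by rw [one_smul, E.sum_conjTranspose_mul]), traceOne_noise, one_mul]

theorem traceOne_noise_unit_noise (E : Noise q) :
    traceOne (fun p : Fin E.rank × ((Fin q × Fin q) × Fin E.rank) =>
      E.kraus p.1 * (unitFamily q p.2.1 * E.kraus p.2.2)) = (q : ℂ) ^ 2 := by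
  rw [traceOne_mul (c := 1) (by rw [one_smul, E.sum_conjTranspose_mul])
      (fun p : (Fin q × Fin q) × Fin E.rank => unitFamily q p.1 * E.kraus p.2),
    traceOne_mul (c := q) (by simpa using sum_unitFamily (1 : Matrix (Fin q) (Fin q) ℂ)),
    traceOne_noise]
  ring

end TraceInvariants

/-! ### The average over one gate and its inverse -/

section GateAverage

open scoped Kronecker

variable {n q : ℕ}

theorem continuous_onPair (s t : Fin n) :
    Continuous fun V : Gate q => (onPair s t (gateMatrix V) : Op n q) := by
  refine continuous_matrix fun x y => ?_
  simp only [onPair, Matrix.of_apply]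
  split_ifs
  · exact continuous_gateMatrix.matrix_elem _ _
  · exact continuous_const

/-- The coefficients, in the basis `𝟏, 𝐬`, after averaging over a gate and its inverse. -/
theorem integral_noisy_gate (hq : 2 ≤ q) (E : Noise q) {s t : Fin n} (hst : s ≠ t) (a b : ℂ)
    (X : Op n q) (φ : Op n q →ₗ[ℂ] ℂ) :
    ∫ V : Gate q, φ (conjMap (onPair s t (gateMatrix V))ᴴ (krausOn t E.kraus
      ((a • LinearMap.id + b • krausOn t (unitFamily q) : Op n q →ₗ[ℂ] Op n q)
        (krausOn t E.kraus (krausOn s E.kraus (conjMap (onPair s t (gateMatrix V)) X))))))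
        ∂haarGate q =
      (((q : ℂ) * (E.alpha * (q : ℂ) ^ 2 - 1) / ((q : ℂ) ^ 4 - 1)) * b +
        ((E.alpha * E.beta * (q : ℂ) ^ 4 - 1) / ((q : ℂ) ^ 4 - 1)) * a) * φ X +
      (((q : ℂ) * ((q : ℂ) ^ 2 - E.alpha) / ((q : ℂ) ^ 4 - 1)) * b +
        ((1 - E.alpha * E.beta) * (q : ℂ) ^ 2 / ((q : ℂ) ^ 4 - 1)) * a) *
        φ (krausOn t (unitFamily q) (krausOn s (unitFamily q) X)) := by
  have hq0 : q ≠ 0 := by omega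
  have hqc : (q : ℂ) ≠ 0 := by exact_mod_cast hq0
  have hq4 : (q : ℂ) ^ 4 - 1 ≠ 0 := by
    rw [sub_ne_zero]; norm_cast
    exact (Nat.one_lt_pow (by norm_num) hq).ne'
  have hcont : ∀ {κ : Type} [Fintype κ] (K : κ → Matrix (Fin q × Fin q) (Fin q × Fin q) ℂ),
      Integrable (fun V : Gate q => φ (conjMap (onPair s t (gateMatrix V))ᴴ
        (krausMap (fun k => onPair s t (K k)) (conjMap (onPair s t (gateMatrix V)) X))))
        (haarGate q) := by
    intro κ _ K
    apply integrable_of_continuous_gate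
    have h1 := continuous_onPair (q := q) s t
    have h2 : Continuous φ := φ.continuous_of_finiteDimensional
    have h3 : Continuous (krausMap (fun k => (onPair s t (K k) : Op n q))) :=
      LinearMap.continuous_of_finiteDimensional _
    refine h2.comp ?_
    simp only [conjMap_apply]
    exact ((h1.matrix_conjTranspose.mul (h3.comp ((h1.mul continuous_const).mul
      h1.matrix_conjTranspose))).mul h1.matrix_conjTranspose.matrix_conjTranspose)
  -- Everything between the gate and its inverse is a tensor product: `Φ` on `s`, and either `Φ ∘ Φ`
  -- or `Φ ∘ D ∘ Φ` on `t`. The trace invariants therefore factor over the two qudits.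
  have hK : ∀ Z : Op n q, krausOn t E.kraus
      ((a • LinearMap.id + b • krausOn t (unitFamily q) : Op n q →ₗ[ℂ] Op n q)
        (krausOn t E.kraus (krausOn s E.kraus Z))) =
      a • krausMap (fun p : (Fin E.rank × Fin E.rank) × Fin E.rank =>
        onPair s t (E.kraus p.2 ⊗ₖ (E.kraus p.1.1 * E.kraus p.1.2))) Z +
      b • krausMap (fun p : (Fin E.rank × ((Fin q × Fin q) × Fin E.rank)) × Fin E.rank =>
        onPair s t (E.kraus p.2 ⊗ₖ
          (E.kraus p.1.1 * (unitFamily q p.1.2.1 * E.kraus p.1.2.2)))) Z := by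
    intro Z
    rw [LinearMap.add_apply, LinearMap.smul_apply, LinearMap.smul_apply, LinearMap.id_apply,
      map_add, map_smul, map_smul, krausOn_comp, krausOn_comp t (unitFamily q), krausOn_comp,
      krausOn_comp_krausOn hst, krausOn_comp_krausOn hst]
  simp only [hK, map_add, map_smul, smul_eq_mul]
  rw [integral_add ((hcont _).const_mul _) ((hcont _).const_mul _), integral_const_mul,
    integral_const_mul, integral_conj_krausMap hq hst, integral_conj_krausMap hq hst]
  have e1 := superTrace_kronecker
    (fun p : Fin E.rank × Fin E.rank => E.kraus p.1 * E.kraus p.2) E.kraus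
  have e2 := traceOne_kronecker
    (fun p : Fin E.rank × Fin E.rank => E.kraus p.1 * E.kraus p.2) E.kraus
  have e3 := superTrace_kronecker (fun p : Fin E.rank × ((Fin q × Fin q) × Fin E.rank) =>
      E.kraus p.1 * (unitFamily q p.2.1 * E.kraus p.2.2)) E.kraus
  have e4 := traceOne_kronecker (fun p : Fin E.rank × ((Fin q × Fin q) × Fin E.rank) =>
      E.kraus p.1 * (unitFamily q p.2.1 * E.kraus p.2.2)) E.kraus
  rw [superTrace_noise hq0, superTrace_noise_noise hq0] at e1
  rw [traceOne_noise, traceOne_noise_noise] at e2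
  rw [superTrace_noise hq0, superTrace_noise_unit_noise] at e3
  rw [traceOne_noise, traceOne_noise_unit_noise] at e4
  simp only [superTrace, traceOne] at e1 e2 e3 e4
  rw [e1, e2, e3, e4]
  field_simp
  ring

end GateAverage

/-! ### Resampling one of several independent gates -/

section Resample

variable {m q : ℕ}

/-- The joint law of independent Haar-random gates. -/
noncomputable abbrev haarGates (m q : ℕ) : Measure (Fin m → Gate q) :=
  Measure.pi fun _ => haarGate q

theorem integrable_of_continuous_gates {f : (Fin m → Gate q) → ℂ} (hf : Continuous f) :
    Integrable f (haarGates m q) :=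
  hf.integrable_of_hasCompactSupport (HasCompactSupport.of_compactSpace f)

/-- Replacing one coordinate by an independent copy preserves the product law; on a box, the
discarded coordinate contributes a factor `1`. This isolates the integral over gate `k`. -/
theorem measurePreserving_update (k : Fin m) :
    MeasurePreserving (fun p : (Fin m → Gate q) × Gate q => Function.update p.1 k p.2)
      ((haarGates m q).prod (haarGate q)) (haarGates m q) := by
  have hc : Continuous fun p : (Fin m → Gate q) × Gate q => Function.update p.1 k p.2 :=
    continuous_fst.update k continuous_snd
  refine ⟨hc.measurable, ?_⟩
  symm
  refine Measure.pi_eq fun s hs => ?_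
  rw [Measure.map_apply hc.measurable (MeasurableSet.univ_pi hs)]
  have : (fun p : (Fin m → Gate q) × Gate q => Function.update p.1 k p.2) ⁻¹'
      Set.univ.pi s = (Set.univ.pi (Function.update s k Set.univ)) ×ˢ s k := by
    ext p
    simp only [Set.mem_preimage, Set.mem_pi, Set.mem_univ, true_implies, Set.mem_prod]
    constructor
    · intro h
      refine ⟨fun i => ?_, by simpa using h k⟩
      by_cases hi : i = k
      · subst hi; simp
      · simpa [hi] using h i
    · rintro ⟨h1, h2⟩ i
      by_cases hi : i = k
      · subst hi; simpa using h2
      · simpa [hi] using h1 i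
  rw [this, Measure.prod_prod, Measure.pi_pi,
    Fintype.prod_eq_mul_prod_compl k, Fintype.prod_eq_mul_prod_compl k]
  simp only [Function.update_self, measure_univ, one_mul]
  rw [mul_comm]
  congr 1
  refine Finset.prod_congr rfl fun i hi => ?_
  rw [Function.update_of_ne (by simpa using hi)]

theorem integral_gates_eq_integral_update (k : Fin m) {f : (Fin m → Gate q) → ℂ}
    (hf : Continuous f) :
    ∫ U, f U ∂haarGates m q =
      ∫ U, ∫ V, f (Function.update U k V) ∂haarGate q ∂haarGates m q := by
  have hmp := measurePreserving_update (m := m) (q := q) k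
  have hint := hmp.integrable_comp_of_integrable (integrable_of_continuous_gates hf)
  rw [← hmp.map_eq, integral_map hmp.measurable.aemeasurable hf.aestronglyMeasurable,
    hmp.map_eq]
  exact integral_prod _ hint

end Resample

/-! ### The circuit as a recursion -/

section Circuit

variable {n q : ℕ}

/-- The state after the first `s` steps of the circuit. -/
noncomputable def fwdState (E : Noise q) (U : Fin (n - 1) → Gate q) : ℕ → Op n q
  | 0 => initialState n q
  | s + 1 => if h : s < n - 1 then forwardStep E U (fwdState E U s) ⟨s, h⟩ else fwdState E U s

/-- A rewinding step with noise on the first qudit of the gate. -/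
noncomputable def rewindMap (E : Noise q) (U : Fin (n - 1) → Gate q) (k : Fin (n - 1)) :
    Op n q →ₗ[ℂ] Op n q :=
  krausOn (fstQudit k) E.kraus ∘ₗ conjMap (gateOp U k)ᴴ

/-- The rewinding of the first `s` steps of the circuit. -/
noncomputable def rewindFrom (E : Noise q) (U : Fin (n - 1) → Gate q) :
    ℕ → (Op n q →ₗ[ℂ] Op n q)
  | 0 => LinearMap.id
  | s + 1 => if h : s < n - 1 then rewindFrom E U s ∘ₗ rewindMap E U ⟨s, h⟩ else rewindFrom E U s

theorem forwardStep_eq (E : Noise q) (U : Fin (n - 1) → Gate q) (X : Op n q) (k : Fin (n - 1)) :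
    forwardStep E U X k = krausOn (sndQudit k) E.kraus (krausOn (fstQudit k) E.kraus
      (conjMap (gateOp U k) X)) := by
  rw [forwardStep, noiseOn_eq, noiseOn_eq, conjMap_apply]

theorem rewindStep_of_ne_zero (E : Noise q) (U : Fin (n - 1) → Gate q) (X : Op n q)
    {k : Fin (n - 1)} (hk : (k : ℕ) ≠ 0) : rewindStep E U X k = rewindMap E U k X := by
  rw [rewindStep, if_neg hk, noiseOn_eq, rewindMap, LinearMap.comp_apply, conjMap_apply,
    Matrix.conjTranspose_conjTranspose]

theorem take_succ_finRange {m s : ℕ} (h : s < m) :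
    (List.finRange m).take (s + 1) = (List.finRange m).take s ++ [⟨s, h⟩] := by
  rw [List.take_succ_eq_append_getElem (by simpa using h)]
  simp

theorem circuitState_eq (E : Noise q) (U : Fin (n - 1) → Gate q) :
    circuitState E U = fwdState E U (n - 1) := by
  have h : ∀ s ≤ n - 1, ((List.finRange (n - 1)).take s).foldl (forwardStep E U)
      (initialState n q) = fwdState E U s := by
    intro s
    induction s with
    | zero => intro _; rfl
    | succ s ih =>
      intro hs
      rw [take_succ_finRange (by omega), List.foldl_append, ih (by omega), fwdState,
        dif_pos (by omega)]
      rfl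
  rw [circuitState, ← h (n - 1) le_rfl, List.take_of_length_le (by simp)]

/-- The rewinding omits the noise after the inverse of gate `0`. Adding it makes all steps alike,
and it will be invisible because the first qudit is not read. -/
theorem krausOn_rewoundState (E : Noise q) (U : Fin (n - 1) → Gate q) (hn : 2 < n) :
    krausOn ⟨0, by omega⟩ E.kraus (rewoundState E U) =
      rewindFrom E U (n - 2) (circuitState E U) := by
  have h : ∀ s X, 1 ≤ s → s ≤ n - 1 → krausOn ⟨0, by omega⟩ E.kraus
      (((List.finRange (n - 1)).take s).reverse.foldl (rewindStep E U) X) =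
        rewindFrom E U s X := by
    intro s
    induction s with
    | zero => intro X h; omega
    | succ s ih =>
      intro X _ hs
      rw [take_succ_finRange (by omega), List.reverse_append, List.reverse_singleton,
        List.singleton_append, List.foldl_cons, rewindFrom, dif_pos (by omega),
        LinearMap.comp_apply]
      rcases Nat.eq_zero_or_pos s with rfl | hs0
      · rw [rewindStep, if_pos rfl, rewindMap, LinearMap.comp_apply, conjMap_apply,
          Matrix.conjTranspose_conjTranspose]
        rfl
      · rw [ih _ hs0 (by omega), rewindStep_of_ne_zero _ _ _ hs0.ne']
  rw [rewoundState, List.dropLast_eq_take, List.length_finRange, ← h _ _ (by omega) (by omega)]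
  rfl

/-- The first `s` steps use only gates of index below `s`, so gate `k ≥ s` can be integrated with
this state held fixed. -/
theorem fwdState_update (E : Noise q) (U : Fin (n - 1) → Gate q) (k : Fin (n - 1)) (V : Gate q)
    (s : ℕ) (hs : s ≤ k) : fwdState E (Function.update U k V) s = fwdState E U s := by
  induction s with
  | zero => rfl
  | succ s ih =>
    have h : s < n - 1 := by omega
    have hne : (⟨s, h⟩ : Fin (n - 1)) ≠ k := fun e => by rw [← e] at hs; simp at hs
    simp only [fwdState, dif_pos h, ih (by omega), forwardStep, gateOp, Function.update_of_ne hne]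

theorem rewindFrom_update (E : Noise q) (U : Fin (n - 1) → Gate q) (k : Fin (n - 1)) (V : Gate q)
    (s : ℕ) (hs : s ≤ k) : rewindFrom E (Function.update U k V) s = rewindFrom E U s := by
  induction s with
  | zero => rfl
  | succ s ih =>
    have h : s < n - 1 := by omega
    have hne : (⟨s, h⟩ : Fin (n - 1)) ≠ k := fun e => by rw [← e] at hs; simp at hs
    simp only [rewindFrom, dif_pos h, ih (by omega), rewindMap, gateOp, Function.update_of_ne hne]

theorem continuous_gateOp (k : Fin (n - 1)) :
    Continuous fun U : Fin (n - 1) → Gate q => gateOp U k :=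
  (continuous_onPair _ _).comp (continuous_apply k)

theorem continuous_linearMap (Φ : Op n q →ₗ[ℂ] Op n q) : Continuous Φ :=
  LinearMap.continuous_of_finiteDimensional _

theorem continuous_fwdState (E : Noise q) (s : ℕ) :
    Continuous fun U : Fin (n - 1) → Gate q => fwdState E U s := by
  induction s with
  | zero => exact continuous_const
  | succ s ih =>
    by_cases h : s < n - 1
    · simp only [fwdState, dif_pos h, forwardStep_eq, conjMap_apply]
      exact (continuous_linearMap _).comp ((continuous_linearMap _).comp
        (((continuous_gateOp _).mul ih).mul (continuous_gateOp _).matrix_conjTranspose))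
    · simpa only [fwdState, dif_neg h] using ih

theorem continuous_rewindFrom (E : Noise q) (s : ℕ) {X : (Fin (n - 1) → Gate q) → Op n q}
    (hX : Continuous X) : Continuous fun U : Fin (n - 1) → Gate q => rewindFrom E U s (X U) := by
  induction s generalizing X with
  | zero => exact hX
  | succ s ih =>
    by_cases h : s < n - 1
    · simp only [rewindFrom, dif_pos h, LinearMap.comp_apply]
      refine ih ?_
      simp only [rewindMap, LinearMap.comp_apply, conjMap_apply]
      exact (continuous_linearMap _).comp (((continuous_gateOp _).matrix_conjTranspose.mul hX).mul
        (continuous_gateOp _).matrix_conjTranspose.matrix_conjTranspose)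
    · simpa only [rewindFrom, dif_neg h] using ih hX

theorem gateOp_comm_onQudit (U : Fin (n - 1) → Gate q) {k : Fin (n - 1)} {t : Fin n}
    (ht : (k : ℕ) + 1 < t) (A : Matrix (Fin q) (Fin q) ℂ) :
    gateOp U k * onQudit t A = onQudit t A * gateOp U k := by
  refine onPair_comm_onQudit ?_ ?_ ?_ _ _ <;> simp [fstQudit, sndQudit, Fin.ext_iff] <;> omega

theorem gateOp_conjTranspose_comm_onQudit (U : Fin (n - 1) → Gate q) {k : Fin (n - 1)} {t : Fin n}
    (ht : (k : ℕ) + 1 < t) (A : Matrix (Fin q) (Fin q) ℂ) :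
    (gateOp U k)ᴴ * onQudit t A = onQudit t A * (gateOp U k)ᴴ := by
  have h := congrArg Matrix.conjTranspose (gateOp_comm_onQudit U ht Aᴴ)
  simpa [Matrix.conjTranspose_mul, onQudit_conjTranspose] using h.symm

/-- The first `s` gates reach only the qudits of index at most `s`. -/
theorem awayFrom_rewindFrom (E : Noise q) (U : Fin (n - 1) → Gate q) {s : ℕ} {t : Fin n}
    (ht : s < t) : AwayFrom t (rewindFrom E U s) := by
  induction s with
  | zero => exact AwayFrom.id t
  | succ s ih =>
    by_cases h : s < n - 1
    · simp only [rewindFrom, dif_pos h]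
      refine (ih (by omega)).comp (AwayFrom.comp (awayFrom_krausOn ?_ _) (awayFrom_conjMap ?_ ?_))
      · simp [fstQudit, Fin.ext_iff]; omega
      · exact gateOp_conjTranspose_comm_onQudit U ht
      · intro A
        rw [Matrix.conjTranspose_conjTranspose]
        exact gateOp_comm_onQudit U ht A
    · simpa only [rewindFrom, dif_neg h] using ih (by omega)

theorem onQudit_zeroMat_mul_fwdState (E : Noise q) (U : Fin (n - 1) → Gate q) {s : ℕ} {t : Fin n}
    (ht : s < t) : onQudit t (zeroMat q) * fwdState E U s = fwdState E U s := by
  induction s with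
  | zero => rw [onQudit_zeroMat, fwdState, readProj_mul_initialState]
  | succ s ih =>
    by_cases h : s < n - 1
    · have h1 : AwayFrom t (conjMap (gateOp U ⟨s, h⟩)) :=
        awayFrom_conjMap (gateOp_comm_onQudit U ht) (gateOp_conjTranspose_comm_onQudit U ht)
      have h2 : AwayFrom t (krausOn (fstQudit (⟨s, h⟩ : Fin (n - 1))) E.kraus) :=
        awayFrom_krausOn (by simp [fstQudit, Fin.ext_iff]; omega) _
      have h3 : AwayFrom t (krausOn (sndQudit (⟨s, h⟩ : Fin (n - 1))) E.kraus) :=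
        awayFrom_krausOn (by simp [sndQudit, Fin.ext_iff]; omega) _
      rw [fwdState, dif_pos h, forwardStep_eq, ← (h3 _ _).1, ← (h2 _ _).1, ← (h1 _ _).1,
        ih (by omega)]
    · simpa only [fwdState, dif_neg h] using ih (by omega)

end Circuit

/-! ### The transfer recursion -/

section Recursion

variable {n q : ℕ}

/-- Splits off the readout of the outer qudit of gate `s`; its index is `s + 1`, so its number is `s
+ 2`. -/
theorem readProj_succ {S : ℕ → Prop} {s : ℕ} {t : Fin n} (ht : (t : ℕ) = s + 1) :
    readProj n q (fun m => S m ∧ m ≤ s + 2) = readProj n q (fun m => S m ∧ m ≤ s + 1) *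
      onQudit t (open Classical in if S (s + 2) then zeroMat q else 1) := by
  by_cases h : S (s + 2)
  · rw [if_pos h, onQudit_zeroMat, readProj_mul]
    congr 1
    ext m
    constructor
    · rintro ⟨h1, h2⟩
      by_cases h3 : m ≤ s + 1
      · exact .inl ⟨h1, h3⟩
      · exact .inr (by omega)
    · rintro (⟨h1, h2⟩ | h1)
      · exact ⟨h1, by omega⟩
      · have : m = s + 2 := by omega
        subst this
        exact ⟨h, le_rfl⟩
  · rw [if_neg h, onQudit_one, Matrix.mul_one]
    congr 1
    ext m
    constructor
    · rintro ⟨h1, h2⟩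
      refine ⟨h1, ?_⟩
      by_contra h3
      have : m = s + 2 := by omega
      subst this
      exact h h1
    · rintro ⟨h1, h2⟩
      exact ⟨h1, by omega⟩

theorem trace_zeroMat (hq : 0 < q) : (zeroMat q).trace = 1 := by
  have : NeZero q := ⟨hq.ne'⟩
  rw [Matrix.trace, Finset.sum_eq_single 0]
  · simp [zeroMat]
  · intro c _ hc
    have : (c : ℕ) ≠ 0 := fun h => hc (Fin.ext h)
    rw [zeroMat, Matrix.diag_apply, Matrix.diagonal_apply_eq, if_neg this]
  · simp

/-- The average over the later gates, when the superoperator they leave behind on qudit `s` is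
`a • id + b • 𝟏 Tr`. -/
noncomputable def stageValue (S : ℕ → Prop) (E : Noise q) (a b : ℂ) (s : Fin n)
    (U : Fin (n - 1) → Gate q) : ℂ :=
  (readProj n q (fun m => S m ∧ m ≤ s + 1) * rewindFrom E U s (krausOn s E.kraus
    ((a • LinearMap.id + b • krausOn s (unitFamily q) : Op n q →ₗ[ℂ] Op n q)
      (fwdState E U s)))).trace

/-- The functional through which the state enters before step `s`. -/
noncomputable def stageFunctional (P : Op n q) (E : Noise q) (U : Fin (n - 1) → Gate q)
    (s : Fin n) : Op n q →ₗ[ℂ] ℂ :=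
  Matrix.traceLinearMap _ ℂ ℂ ∘ₗ LinearMap.mulLeft ℂ P ∘ₗ rewindFrom E U s ∘ₗ krausOn s E.kraus

theorem stageFunctional_apply (P : Op n q) (E : Noise q) (U : Fin (n - 1) → Gate q)
    (s : Fin n) (X : Op n q) :
    stageFunctional P E U s X = (P * rewindFrom E U s (krausOn s E.kraus X)).trace := rfl

theorem continuous_trace_mul_rewindFrom (E : Noise q) (P : Op n q) (s : ℕ)
    {X : (Fin (n - 1) → Gate q) → Op n q} (hX : Continuous X) :
    Continuous fun U => (P * rewindFrom E U s (X U)).trace :=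
  (continuous_const.mul (continuous_rewindFrom E s hX)).matrix_trace

theorem continuous_stageValue (S : ℕ → Prop) (E : Noise q) (a b : ℂ) (s : Fin n) :
    Continuous (stageValue S E a b s) :=
  continuous_trace_mul_rewindFrom E _ s ((continuous_linearMap _).comp
    ((continuous_linearMap _).comp (continuous_fwdState E s)))

theorem not_le_of_eq_succ {S : ℕ → Prop} {s : Fin n} {t : Fin n} (ht : (t : ℕ) = s + 1) :
    ¬ (S (t + 1) ∧ (t : ℕ) + 1 ≤ s + 1) := fun h => by omega

/-- The identity term of the gate average: `t` is still in `|0⟩` and the readout projector is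
absorbed by the state. -/
theorem stageFunctional_initial {S : ℕ → Prop} (E : Noise q) (U : Fin (n - 1) → Gate q)
    {s t : Fin n} (ht : (t : ℕ) = s + 1) {X : Op n q} (hX : onQudit t (zeroMat q) * X = X) :
    stageFunctional (readProj n q (fun m => S m ∧ m ≤ s + 2)) E U s X =
      stageFunctional (readProj n q (fun m => S m ∧ m ≤ s + 1)) E U s X := by
  have hs : s ≠ t := fun h => by rw [h] at ht; omega
  rw [stageFunctional_apply, stageFunctional_apply, readProj_succ ht]
  split_ifs
  · rw [Matrix.mul_assoc, ← (awayFrom_rewindFrom E U (s := s) (t := t) (by omega) _ _).1,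
      ← (awayFrom_krausOn hs _ _ _).1, hX]
  · rw [onQudit_one, Matrix.mul_one]

/-- The depolarised term of the gate average: the trace of the local observable is `1` or `q`
according to whether `t` is read. -/
theorem stageFunctional_depolarized {S : ℕ → Prop} (E : Noise q) (U : Fin (n - 1) → Gate q)
    {s t : Fin n} (ht : (t : ℕ) = s + 1) (X : Op n q) :
    stageFunctional (readProj n q (fun m => S m ∧ m ≤ s + 2)) E U s
        (krausOn t (unitFamily q) X) =
      (open Classical in if S (s + 2) then zeroMat q else 1).trace *
        stageFunctional (readProj n q (fun m => S m ∧ m ≤ s + 1)) E U s X := by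
  have hs : s ≠ t := fun h => by rw [h] at ht; omega
  rw [stageFunctional_apply, stageFunctional_apply, readProj_succ ht,
    (awayFrom_krausOn hs _).krausOn_comm,
    (awayFrom_rewindFrom E U (s := s) (t := t) (by omega)).krausOn_comm,
    trace_mul_krausOn_unitFamily (fun A => readProj_comm_onQudit (not_le_of_eq_succ ht) A)]

open Classical in
/-- The transfer matrix of the qudit with number `m`. -/
noncomputable def transferAt (S : ℕ → Prop) (q : ℕ) (α β : ℝ) (m : ℕ) : Matrix (Fin 2) (Fin 2) ℝ :=
  if S m then transferRead q α β else transfer q α β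

/-- One integration turns the superoperator left on `t` into one of the same shape on `s`. The
vector `c` lists the coefficient of `D` first, while `stageValue` takes the coefficient of `id`
first; hence `c 1` before `c 0`. -/
theorem integral_stageValue_succ (hq : 2 ≤ q) (S : ℕ → Prop) (E : Noise q) (c : Fin 2 → ℝ)
    {s t : Fin n} (ht : (t : ℕ) = s + 1) :
    ∫ U, stageValue S E (c 1 : ℝ) (c 0 : ℝ) t U ∂haarGates (n - 1) q =
      ∫ U, stageValue S E
        ((transferAt S q E.alpha E.beta (s + 2) *ᵥ c) 1 : ℝ)
        ((transferAt S q E.alpha E.beta (s + 2) *ᵥ c) 0 : ℝ) s U ∂haarGates (n - 1) q := by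
  have hsn : (s : ℕ) < n - 1 := by omega
  set k : Fin (n - 1) := ⟨s, hsn⟩ with hk
  have hs : s ≠ t := fun h => by rw [h] at ht; omega
  have hfst : fstQudit k = s := rfl
  have hsnd : sndQudit k = t := Fin.ext ht.symm
  rw [integral_gates_eq_integral_update k (continuous_stageValue S E _ _ t)]
  congr 1
  ext U
  have h1 : ∀ V : Gate q, stageValue S E (c 1 : ℝ) (c 0 : ℝ) t (Function.update U k V) =
      stageFunctional (readProj n q (fun m => S m ∧ m ≤ s + 2)) E U s
        (conjMap (onPair s t (gateMatrix V))ᴴ (krausOn t E.kraus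
        ((((c 1 : ℝ) : ℂ) • LinearMap.id + ((c 0 : ℝ) : ℂ) • krausOn t (unitFamily q) :
            Op n q →ₗ[ℂ] Op n q)
        (krausOn t E.kraus (krausOn s E.kraus (conjMap (onPair s t (gateMatrix V))
          (fwdState E U s))))))) := by
    intro V
    have hg : gateOp (Function.update U k V) k = onPair s t (gateMatrix V) := by
      rw [gateOp, Function.update_self, hfst, hsnd]
    rw [stageValue, ht, rewindFrom, fwdState, dif_pos hsn, dif_pos hsn, ← hk,
      rewindFrom_update E U k V s le_rfl, fwdState_update E U k V s le_rfl, forwardStep_eq,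
      LinearMap.comp_apply, rewindMap, LinearMap.comp_apply, hg, hfst, hsnd, stageFunctional_apply]
  simp only [h1]
  rw [integral_noisy_gate hq E hs]
  have hX : onQudit t (zeroMat q) * fwdState E U s = fwdState E U s :=
    onQudit_zeroMat_mul_fwdState E U (by omega)
  rw [stageFunctional_initial E U ht hX, stageFunctional_depolarized E U ht]
  have h2 : ∀ a b : ℂ, stageValue S E a b s U =
      a * stageFunctional (readProj n q (fun m => S m ∧ m ≤ s + 1)) E U s (fwdState E U s) +
      b * stageFunctional (readProj n q (fun m => S m ∧ m ≤ s + 1)) E U s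
        (krausOn s (unitFamily q) (fwdState E U s)) := by
    intro a b
    rw [stageValue, ← stageFunctional_apply]
    simp only [LinearMap.add_apply, LinearMap.smul_apply, LinearMap.id_apply, map_add, map_smul,
      smul_eq_mul]
  rw [h2]
  congr 1
  -- The `id` coefficient is the second row, which the two transfer matrices share.
  · congr 1
    rw [transferAt]
    split_ifs <;>
    · simp [transfer, transferRead, Matrix.mulVec, dotProduct, Fin.sum_univ_two]
  · rw [← mul_assoc]
    congr 1
    rw [transferAt]
    split_ifs
    · rw [trace_zeroMat (by omega)]
      simp [transferRead, Matrix.mulVec, dotProduct, Fin.sum_univ_two]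
    · simp [transfer, Matrix.mulVec, dotProduct, Fin.sum_univ_two]
      ring

/-- The last gate, which is not rewound. -/
theorem integral_last_gate (hq : 2 ≤ q) {S : ℕ → Prop} (hS : ∀ m, S m → m < n) (E : Noise q)
    {s t : Fin n} (ht : (t : ℕ) = s + 1) (hn : (s : ℕ) + 2 = n) :
    ∫ U, (readProj n q S * rewindFrom E U (n - 2) (circuitState E U)).trace
        ∂haarGates (n - 1) q =
      ∫ U, stageValue S E 0 ((1 / (q : ℝ) : ℝ) : ℂ) s U ∂haarGates (n - 1) q := by
  have hsn : (s : ℕ) < n - 1 := by omega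
  set k : Fin (n - 1) := ⟨s, hsn⟩ with hk
  have hs : s ≠ t := fun h => by rw [h] at ht; omega
  have hfst : fstQudit k = s := rfl
  have hsnd : sndQudit k = t := Fin.ext ht.symm
  have hSP : readProj n q S = readProj n q (fun m => S m ∧ m ≤ s + 1) := by
    congr 1
    ext m
    exact ⟨fun h => ⟨h, by have := hS m h; omega⟩, fun h => h.1⟩
  have hn2 : n - 2 = s := by omega
  have hc : Continuous fun U => (readProj n q S *
      rewindFrom E U (n - 2) (circuitState E U)).trace := by
    exact continuous_trace_mul_rewindFrom E _ _
      ((continuous_fwdState E (n - 1)).congr fun U => (circuitState_eq E U).symm)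
  rw [integral_gates_eq_integral_update k hc]
  congr 1
  ext U
  have h1 : ∀ V : Gate q, (readProj n q S * rewindFrom E (Function.update U k V) (n - 2)
      (circuitState E (Function.update U k V))).trace =
      stageFunctional (readProj n q (fun m => S m ∧ m ≤ s + 1)) E U s
        (conjMap (onPair s t (gateMatrix V)) (fwdState E U s)) := by
    intro V
    have hg : gateOp (Function.update U k V) k = onPair s t (gateMatrix V) := by
      rw [gateOp, Function.update_self, hfst, hsnd]
    have hc : ∀ U : Fin (n - 1) → Gate q, circuitState E U = fwdState E U (s + 1) := fun U => by
      rw [circuitState_eq]; congr 1; omega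
    rw [hc, hn2, fwdState, dif_pos hsn, ← hk,
      rewindFrom_update E U k V s le_rfl, fwdState_update E U k V s le_rfl, forwardStep_eq,
      hg, hfst, hsnd, stageFunctional_apply, hSP,
      (awayFrom_rewindFrom E U (s := s) (t := t) (by omega)).krausOn_comm,
      trace_mul_krausOn_of_tracePreserving
        (fun A => readProj_comm_onQudit (not_le_of_eq_succ ht) A) E.sum_conjTranspose_mul]
  simp only [h1]
  -- Averaging a gate that is not undone depolarises both qudits with weight `1/q²`; tracing out the
  -- unread last qudit gives back a factor `q`, so `b = 1/q` and `a = 0`.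
  rw [integral_conjMap_onPair hq hs]
  have hno : ¬ (S (t + 1)) := fun h => by have := hS _ h; omega
  have h3 : ∀ X : Op n q, stageFunctional (readProj n q (fun m => S m ∧ m ≤ s + 1)) E U s
      (krausOn t (unitFamily q) X) =
      (q : ℂ) * stageFunctional (readProj n q (fun m => S m ∧ m ≤ s + 1)) E U s X := by
    intro X
    have h := trace_mul_krausOn_unitFamily (t := t) (P := readProj n q (fun m => S m ∧ m ≤ s + 1))
      (fun A => readProj_comm_onQudit (not_le_of_eq_succ ht) A) 1
      (rewindFrom E U s (krausOn s E.kraus X))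
    rw [onQudit_one, Matrix.mul_one] at h
    rw [stageFunctional_apply, stageFunctional_apply,
      (awayFrom_krausOn hs _).krausOn_comm,
      (awayFrom_rewindFrom E U (s := s) (t := t) (by omega)).krausOn_comm, h]
    simp
  have hqc : (q : ℂ) ≠ 0 := by norm_cast; omega
  rw [h3, stageValue, ← stageFunctional_apply]
  simp only [LinearMap.add_apply, LinearMap.smul_apply, LinearMap.id_apply, map_add, map_smul,
    smul_eq_mul]
  push_cast
  field_simp
  ring

/-- The first qudit is not read out. -/
theorem stageValue_zero (hq : 2 ≤ q) {S : ℕ → Prop} (hS : ∀ m, S m → 2 ≤ m) (E : Noise q)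
    (a b : ℂ) (s : Fin n) (hs : (s : ℕ) = 0) (U : Fin (n - 1) → Gate q) :
    stageValue S E a b s U = (q : ℂ) * b + a := by
  have h1 : readProj n q (fun m => S m ∧ m ≤ s + 1) = 1 :=
    readProj_of_forall_not fun m h => by have := hS _ h.1; omega
  have h2 := fun X : Op n q => trace_mul_krausOn_of_tracePreserving (t := s) (P := (1 : Op n q))
    (fun A => by rw [Matrix.one_mul, Matrix.mul_one]) E.sum_conjTranspose_mul X
  have h3 := trace_mul_krausOn_unitFamily (t := s) (P := (1 : Op n q))
    (fun A => by rw [Matrix.one_mul, Matrix.mul_one]) 1 (initialState n q)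
  rw [onQudit_one, Matrix.mul_one] at h3
  simp only [Matrix.one_mul, Matrix.trace_one, Fintype.card_fin,
    trace_initialState (show 0 < q by omega)] at h2 h3
  rw [stageValue, h1, hs, rewindFrom, fwdState, Matrix.one_mul, LinearMap.id_apply, h2,
    LinearMap.add_apply, LinearMap.smul_apply, LinearMap.smul_apply, LinearMap.id_apply,
    Matrix.trace_add, Matrix.trace_smul, Matrix.trace_smul, h3,
    trace_initialState (show 0 < q by omega)]
  simp only [smul_eq_mul]
  ring

/-- The product of the transfer matrices of the qudits with numbers `2, …, s + 1`. -/
noncomputable def transferProd (S : ℕ → Prop) (q : ℕ) (α β : ℝ) : ℕ → Matrix (Fin 2) (Fin 2) ℝ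
  | 0 => 1
  | s + 1 => transferProd S q α β s * transferAt S q α β (s + 2)

theorem integral_stageValue (hq : 2 ≤ q) {S : ℕ → Prop} (hS : ∀ m, S m → 2 ≤ m) (E : Noise q)
    (s : ℕ) (hs : s < n) (c : Fin 2 → ℝ) :
    ∫ U, stageValue S E (c 1 : ℝ) (c 0 : ℝ) (⟨s, hs⟩ : Fin n) U ∂haarGates (n - 1) q =
      ((q * (transferProd S q E.alpha E.beta s *ᵥ c) 0 +
        (transferProd S q E.alpha E.beta s *ᵥ c) 1 : ℝ) : ℂ) := by
  induction s generalizing c with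
  | zero =>
    simp only [stageValue_zero hq hS E _ _ (⟨0, hs⟩ : Fin n) rfl]
    simp [transferProd]
  | succ s ih =>
    rw [integral_stageValue_succ hq S E c (s := ⟨s, by omega⟩) (t := ⟨s + 1, hs⟩) rfl, ih,
      transferProd, Matrix.mulVec_mulVec]

/-- The averaged probability that all qudits with number in `S` are found in `|0⟩`. -/
theorem integral_readProj_rewoundState (hq : 2 ≤ q) {S : ℕ → Prop}
    (hS : ∀ m, S m → 2 ≤ m ∧ m < n) (E : Noise q) (hn : 2 < n) :
    ∫ U : Fin (n - 1) → Gate q, (readProj n q S * rewoundState E U).trace.re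
        ∂(Measure.pi fun _ => haarGate q) =
      boundaryValue q (transferProd S q E.alpha E.beta (n - 2)) := by
  have h1 : ∀ U : Fin (n - 1) → Gate q, (readProj n q S * rewoundState E U).trace =
      (readProj n q S * rewindFrom E U (n - 2) (circuitState E U)).trace := by
    intro U
    rw [← krausOn_rewoundState E U hn, trace_mul_krausOn_of_tracePreserving
      (fun A => readProj_comm_onQudit (fun h => by have := (hS _ h).1; simp at this) A)
      E.sum_conjTranspose_mul]
  have hc : Continuous fun U => (readProj n q S *
      rewindFrom E U (n - 2) (circuitState E U)).trace := by
    exact continuous_trace_mul_rewindFrom E _ _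
      ((continuous_fwdState E (n - 1)).congr fun U => (circuitState_eq E U).symm)
  simp only [h1]
  have h2 := integral_re (integrable_of_continuous_gates hc)
  simp only [RCLike.re_eq_complex_re] at h2
  rw [h2, integral_last_gate hq (fun m h => (hS m h).2) E (s := ⟨n - 2, by omega⟩)
    (t := ⟨n - 1, by omega⟩) (by simp; omega) (by simp; omega)]
  have h3 := integral_stageValue (n := n) hq (fun m h => (hS m h).1) E (n - 2) (by omega)
    ![1 / (q : ℝ), 0]
  simp only [Matrix.cons_val_zero, Matrix.cons_val_one, Complex.ofReal_zero] at h3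
  rw [h3, Complex.ofReal_re, boundaryValue]
  simp [Matrix.mulVec, dotProduct, Fin.sum_univ_two, mul_comm]

end Recursion

/-! ### Fidelities as functions of `α` and `β` -/

section Formal

/-- A run of `k` unread qudits contributes a pure power of `transfer`; the readouts are inserted by
`transferProd_succ_of_mem`. -/
theorem transferProd_add (S : ℕ → Prop) (q : ℕ) (α β : ℝ) (s k : ℕ)
    (h : ∀ m, s + 2 ≤ m → m < s + 2 + k → ¬ S m) :
    transferProd S q α β (s + k) = transferProd S q α β s * transfer q α β ^ k := by
  induction k with
  | zero => simp
  | succ k ih =>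
    rw [← add_assoc, transferProd, ih fun m h1 h2 => h m h1 (by omega), transferAt,
      if_neg (h _ (by omega) (by omega)), pow_succ, Matrix.mul_assoc]

theorem transferProd_succ_of_mem {S : ℕ → Prop} (q : ℕ) (α β : ℝ) {s : ℕ} (h : S (s + 2)) :
    transferProd S q α β (s + 1) = transferProd S q α β s * transferRead q α β := by
  rw [transferProd, transferAt, if_pos h]

theorem fidelity_eq_formalFidelity {q : ℕ} (hq : 2 ≤ q) (E : Noise q) {n i : ℕ} (hi : 2 ≤ i)
    (hn : i < n) : fidelity E n i = formalFidelity q E.alpha E.beta n i := by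
  simp only [fidelity, zeroProj_eq_readProj]
  rw [integral_readProj_rewoundState hq (by rintro m rfl; exact ⟨hi, hn⟩) E (by omega),
    formalFidelity]
  congr 1
  obtain ⟨a, rfl⟩ := Nat.exists_eq_add_of_le' hi
  obtain ⟨b, rfl⟩ := Nat.exists_eq_add_of_lt hn
  rw [show a + 2 + b + 1 - 2 = a + 1 + b by omega, show a + 2 + b + 1 - (a + 2) - 1 = b by omega,
    transferProd_add _ _ _ _ _ _ (by intros; omega),
    transferProd_succ_of_mem (S := fun m => m = a + 2) _ _ _ rfl,
    show a = 0 + a by omega, transferProd_add _ _ _ _ _ _ (by intros; omega)]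
  simp [transferProd]

theorem jointFidelity_eq_formalJointFidelity {q : ℕ} (hq : 2 ≤ q) (E : Noise q) {n i j : ℕ}
    (hj : 2 ≤ j) (hij : j < i) (hn : i < n) :
    jointFidelity E n i j = formalJointFidelity q E.alpha E.beta n i j := by
  simp only [jointFidelity, zeroProj_eq_readProj, readProj_mul]
  rw [integral_readProj_rewoundState hq (by rintro m (rfl | rfl) <;> constructor <;> omega) E
    (by omega), formalJointFidelity]
  congr 1
  obtain ⟨a, rfl⟩ := Nat.exists_eq_add_of_le' hj
  obtain ⟨b, rfl⟩ := Nat.exists_eq_add_of_lt hij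
  obtain ⟨c, rfl⟩ := Nat.exists_eq_add_of_lt hn
  rw [show a + 2 + b + 1 + c + 1 - 2 = a + 1 + b + 1 + c by omega,
    show a + 2 + b + 1 + c + 1 - (a + 2 + b + 1) - 1 = c by omega,
    show a + 2 + b + 1 - (a + 2) - 1 = b by omega,
    transferProd_add _ _ _ _ _ _ (by intros; omega),
    transferProd_succ_of_mem _ _ _ (by left; omega),
    transferProd_add _ _ _ _ _ _ (by intros; omega),
    transferProd_succ_of_mem _ _ _ (by right; omega),
    show a = 0 + a by omega, transferProd_add _ _ _ _ _ _ (by intros; omega)]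
  simp [transferProd]

theorem connectedCorrelation_eq_formalCorrelation {q : ℕ} (hq : 2 ≤ q) (E : Noise q)
    {n i j : ℕ} (hj : 2 ≤ j) (hij : j < i) (hn : i < n) :
    connectedCorrelation E n i j = formalCorrelation q E.alpha E.beta n i j := by
  rw [connectedCorrelation, formalCorrelation, fidelity_eq_formalFidelity hq E (by omega) hn,
    fidelity_eq_formalFidelity hq E hj (by omega),
    jointFidelity_eq_formalJointFidelity hq E hj hij hn]

end Formal

/-! ### Bounds on the entanglement fidelity -/

theorem Noise.alpha_nonneg {q : ℕ} (E : Noise q) : 0 ≤ E.alpha :=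
  div_nonneg (Finset.sum_nonneg fun _ _ => by positivity) (by positivity)

/-- Cauchy–Schwarz on the diagonal; summed over the Kraus operators it bounds `α` by trace
preservation. -/
theorem norm_trace_sq_le {q : ℕ} (A : Matrix (Fin q) (Fin q) ℂ) :
    ‖A.trace‖ ^ 2 ≤ q * ((Aᴴ * A).trace).re := by
  have h1 : ((Aᴴ * A).trace).re = ∑ x, ∑ y, ‖A y x‖ ^ 2 := by
    simp only [Matrix.trace, Matrix.diag_apply, Matrix.mul_apply, Matrix.conjTranspose_apply,
      Complex.re_sum, Complex.star_def, mul_comm, Complex.mul_conj, Complex.normSq_eq_norm_sq,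
      Complex.ofReal_re]
  rw [h1]
  calc ‖A.trace‖ ^ 2 ≤ (∑ x, ‖A x x‖) ^ 2 := by
        gcongr
        exact norm_sum_le _ _
    _ ≤ q * ∑ x, ‖A x x‖ ^ 2 := by
        simpa using sq_sum_le_card_mul_sum_sq (s := Finset.univ) (f := fun x => ‖A x x‖)
    _ ≤ q * ∑ x, ∑ y, ‖A y x‖ ^ 2 := by
        gcongr with x
        exact Finset.single_le_sum (f := fun y => ‖A y x‖ ^ 2) (fun _ _ => by positivity)
          (Finset.mem_univ x)

theorem Noise.alpha_le_one {q : ℕ} (E : Noise q) : E.alpha ≤ 1 := by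
  refine div_le_one_of_le₀ ?_ (by positivity)
  calc ∑ k, ‖(E.kraus k).trace‖ ^ 2
      ≤ ∑ k, (q : ℝ) * (((E.kraus k)ᴴ * E.kraus k).trace).re :=
        Finset.sum_le_sum fun k _ => norm_trace_sq_le _
    _ = (q : ℝ) ^ 2 := by
        rw [← Finset.mul_sum, ← Complex.re_sum, ← Matrix.trace_sum, E.sum_conjTranspose_mul]
        simp [sq]

/-! ### The limit of long circuits -/

section Limit

open Matrix

/-- The second eigenvalue of the transfer matrix. -/
noncomputable def decayRate (q : ℕ) (α β : ℝ) : ℝ :=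
  (α * β * (q : ℝ) ^ 4 - α * (q : ℝ) ^ 2) / ((q : ℝ) ^ 4 - 1)

/-- The first component of the fixed vector of the transfer matrix. -/
noncomputable def fixedWeight (q : ℕ) (α β : ℝ) : ℝ :=
  (1 - α * β) * (q : ℝ) ^ 3 / ((q : ℝ) ^ 4 - 1) / (1 - decayRate q α β)

/-- The fixed vector of the transfer matrix. -/
noncomputable def fixedVec (q : ℕ) (α β : ℝ) : Fin 2 → ℝ :=
  ![fixedWeight q α β, 1 - q * fixedWeight q α β]

/-- The trace as a row vector. -/
def traceRow (q : ℕ) : Fin 2 → ℝ := ![q, 1]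

variable {q : ℕ}

theorem pow_four_sub_one_ne_zero (hq : 2 ≤ q) : (q : ℝ) ^ 4 - 1 ≠ 0 := by
  rw [sub_ne_zero]; norm_cast
  exact (Nat.one_lt_pow (by norm_num) hq).ne'

theorem traceRow_vecMul_transfer (hq : 2 ≤ q) (α β : ℝ) :
    traceRow q ᵥ* transfer q α β = traceRow q := by
  have hq4 := pow_four_sub_one_ne_zero hq
  ext x
  fin_cases x <;> simp [traceRow, transfer, vecMul, dotProduct, Fin.sum_univ_two] <;>
    field_simp <;> ring

theorem traceRow_vecMul_transfer_pow (hq : 2 ≤ q) (α β : ℝ) (m : ℕ) :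
    traceRow q ᵥ* transfer q α β ^ m = traceRow q := by
  induction m with
  | zero => simp
  | succ m ih => rw [pow_succ, ← vecMul_vecMul, ih, traceRow_vecMul_transfer hq]

theorem transfer_mulVec_fixedVec (hq : 2 ≤ q) {α β : ℝ} (h : decayRate q α β ≠ 1) :
    transfer q α β *ᵥ fixedVec q α β = fixedVec q α β := by
  have hq4 := pow_four_sub_one_ne_zero hq
  have h1 : 1 - decayRate q α β ≠ 0 := sub_ne_zero.mpr h.symm
  have h2 : fixedWeight q α β * (1 - decayRate q α β) =
      (1 - α * β) * (q : ℝ) ^ 3 / ((q : ℝ) ^ 4 - 1) := by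
    rw [fixedWeight]; field_simp
  -- The defining equation of the weight, cleared of denominators: both components of the
  -- fixed-point equation are multiples of it.
  have h3 : fixedWeight q α β * ((q : ℝ) ^ 4 - 1 - (α * β * (q : ℝ) ^ 4 - α * (q : ℝ) ^ 2)) =
      (1 - α * β) * (q : ℝ) ^ 3 := by
    rw [decayRate] at h2
    field_simp at h2
    linear_combination h2
  ext x
  fin_cases x
  · simp [fixedVec, transfer, mulVec, dotProduct, Fin.sum_univ_two]
    field_simp
    linear_combination -h3
  · simp [fixedVec, transfer, mulVec, dotProduct, Fin.sum_univ_two]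
    field_simp
    linear_combination (q : ℝ) * h3

/-- The kernel of an invariant row is an invariant line, here spanned by `(1, -q)`, so `transfer`
acts on it by its other eigenvalue. -/
theorem transfer_mulVec_of_traceRow_eq_zero (hq : 2 ≤ q) (α β : ℝ) {w : Fin 2 → ℝ}
    (hw : traceRow q ⬝ᵥ w = 0) : transfer q α β *ᵥ w = decayRate q α β • w := by
  have hq4 := pow_four_sub_one_ne_zero hq
  have h1 : w 1 = -(q * w 0) := by
    simp [traceRow, dotProduct, Fin.sum_univ_two] at hw
    linarith
  ext x
  fin_cases x <;> simp [transfer, decayRate, mulVec, dotProduct, Fin.sum_univ_two, h1] <;>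
    field_simp <;> ring

theorem traceRow_dotProduct_fixedVec (α β : ℝ) : traceRow q ⬝ᵥ fixedVec q α β = 1 := by
  simp [traceRow, fixedVec, dotProduct, Fin.sum_univ_two]

theorem transfer_pow_mulVec (hq : 2 ≤ q) {α β : ℝ} (h : decayRate q α β ≠ 1) (m : ℕ)
    (w : Fin 2 → ℝ) :
    transfer q α β ^ m *ᵥ w = (traceRow q ⬝ᵥ w) • fixedVec q α β +
      decayRate q α β ^ m • (w - (traceRow q ⬝ᵥ w) • fixedVec q α β) := by
  induction m with
  | zero => simp
  | succ m ih =>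
    have h0 : traceRow q ⬝ᵥ (w - (traceRow q ⬝ᵥ w) • fixedVec q α β) = 0 := by
      rw [dotProduct_sub, dotProduct_smul, traceRow_dotProduct_fixedVec]
      simp
    rw [pow_succ', ← mulVec_mulVec, ih, mulVec_add, mulVec_smul, mulVec_smul,
      transfer_mulVec_fixedVec hq h, transfer_mulVec_of_traceRow_eq_zero hq α β h0, smul_smul,
      pow_succ]

theorem boundaryValue_eq (M : Matrix (Fin 2) (Fin 2) ℝ) :
    boundaryValue q M = traceRow q ⬝ᵥ (M *ᵥ ![1 / (q : ℝ), 0]) := by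
  simp [boundaryValue, traceRow, mulVec, dotProduct, Fin.sum_univ_two, mul_comm]

/-- The leftmost powers of `transfer` are absorbed by the invariant row. Only the distance `i - j`
and the distances to the end of the chain remain. -/
theorem formalCorrelation_eq (hq : 2 ≤ q) (α β : ℝ) (n i j : ℕ) :
    formalCorrelation q α β n i j =
      traceRow q ⬝ᵥ (transferRead q α β *ᵥ (transfer q α β ^ (i - j - 1) *ᵥ
        (transferRead q α β *ᵥ (transfer q α β ^ (n - i - 1) *ᵥ ![1 / (q : ℝ), 0])))) -
      (traceRow q ⬝ᵥ (transferRead q α β *ᵥ (transfer q α β ^ (n - i - 1) *ᵥ ![1 / (q : ℝ), 0]))) *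
      (traceRow q ⬝ᵥ (transferRead q α β *ᵥ (transfer q α β ^ (n - j - 1) *ᵥ
        ![1 / (q : ℝ), 0]))) := by
  simp only [formalCorrelation, formalJointFidelity, formalFidelity, boundaryValue_eq,
    mulVec_mulVec, Matrix.mul_assoc]
  rw [← mulVec_mulVec _ (transfer q α β ^ (j - 2)), ← mulVec_mulVec _ (transfer q α β ^ (i - 2)),
    ← mulVec_mulVec _ (transfer q α β ^ (j - 2))]
  simp only [dotProduct_mulVec, traceRow_vecMul_transfer_pow hq]

theorem decayRate_one (hq : 2 ≤ q) (α : ℝ) :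
    decayRate q α 1 = α * (q : ℝ) ^ 2 / ((q : ℝ) ^ 2 + 1) := by
  have hq4 := pow_four_sub_one_ne_zero hq
  have : (q : ℝ) ^ 2 + 1 ≠ 0 := by positivity
  rw [decayRate, div_eq_div_iff hq4 this]
  ring

theorem decay_nonneg {α : ℝ} (h0 : 0 ≤ α) : 0 ≤ α * (q : ℝ) ^ 2 / ((q : ℝ) ^ 2 + 1) := by
  positivity

theorem decay_lt_one {α : ℝ} (h1 : α ≤ 1) : α * (q : ℝ) ^ 2 / ((q : ℝ) ^ 2 + 1) < 1 := by
  rw [div_lt_one (by positivity)]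
  nlinarith [sq_nonneg (q : ℝ)]

/-- The limiting correlation. -/
noncomputable def limitCorrelation (q i j : ℕ) (α : ℝ) : ℝ :=
  (1 - α) * (q : ℝ) ^ 2 * (α * (q : ℝ) ^ 2 - 1) /
    (((q : ℝ) + 1) ^ 2 * ((1 - α) * (q : ℝ) ^ 2 + 1) ^ 2) *
  (α * (q : ℝ) ^ 2 / ((q : ℝ) ^ 2 + 1)) ^ (i - j)

/-- The value at `β = 1` once the long powers are replaced by their limit `fixedVec`. -/
theorem fixedVec_correlation (hq : 2 ≤ q) {i j : ℕ} (hij : j < i) {α : ℝ} (h1 : α ≤ 1) :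
    traceRow q ⬝ᵥ (transferRead q α 1 *ᵥ (transfer q α 1 ^ (i - j - 1) *ᵥ
        (transferRead q α 1 *ᵥ fixedVec q α 1))) -
      (traceRow q ⬝ᵥ (transferRead q α 1 *ᵥ fixedVec q α 1)) *
      (traceRow q ⬝ᵥ (transferRead q α 1 *ᵥ fixedVec q α 1)) = limitCorrelation q i j α := by
  have hne : decayRate q α 1 ≠ 1 := by
    rw [decayRate_one hq]; exact (decay_lt_one h1).ne
  obtain ⟨k, rfl⟩ := Nat.exists_eq_add_of_lt hij
  rw [show j + k + 1 - j - 1 = k by omega, transfer_pow_mulVec hq hne, limitCorrelation,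
    show j + k + 1 - j = k + 1 by omega, decayRate_one hq, pow_succ _ k]
  have hD : (1 - α) * (q : ℝ) ^ 2 + 1 ≠ 0 := by nlinarith [sq_nonneg (q : ℝ)]
  have hq2 : (q : ℝ) ^ 2 + 1 ≠ 0 := by positivity
  have hqp : (q : ℝ) + 1 ≠ 0 := by positivity
  have hqm : (q : ℝ) - 1 ≠ 0 := by
    rw [sub_ne_zero]; norm_cast; omega
  have hfac : (q : ℝ) ^ 4 - 1 = (q - 1) * (q + 1) * ((q : ℝ) ^ 2 + 1) := by ring
  have hw : fixedWeight q α 1 =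
      (1 - α) * (q : ℝ) ^ 3 / ((q - 1) * (q + 1) * ((1 - α) * (q : ℝ) ^ 2 + 1)) := by
    have h2 : 1 - decayRate q α 1 = ((1 - α) * (q : ℝ) ^ 2 + 1) / ((q : ℝ) ^ 2 + 1) := by
      rw [decayRate_one hq]; field_simp; ring
    rw [fixedWeight, h2, hfac]
    field_simp
  -- The projection part of the middle power equals the product of the two fidelities and cancels.
  -- What remains carries `decayRate ^ k` with `k = i - j - 1`; the missing factor of the rate comes
  -- from the rational identity below.
  rw [mulVec_add, mulVec_smul, mulVec_smul, dotProduct_add, dotProduct_smul, dotProduct_smul,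
    smul_eq_mul, smul_eq_mul, add_sub_cancel_left, mul_comm, mul_comm (_ ^ k), ← mul_assoc]
  congr 1
  have hq0 : (q : ℝ) ≠ 0 := by norm_cast; omega
  -- Taking the denominator as the variable in place of `α` leaves a rational identity in `q` and
  -- `D` with known nonzero factors.
  generalize hDα : (1 - α) * (q : ℝ) ^ 2 + 1 = D at hD hw ⊢
  have hα : α = ((q : ℝ) ^ 2 + 1 - D) / (q : ℝ) ^ 2 := by
    rw [← hDα]; field_simp; ring
  simp only [traceRow, transferRead, fixedVec, hw, hfac, mulVec, dotProduct, Fin.sum_univ_two,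
    Matrix.of_apply, Matrix.cons_val_zero, Matrix.cons_val_one, Pi.sub_apply, Pi.smul_apply,
    smul_eq_mul]
  rw [hα]
  field_simp
  ring

/-- Base and exponent vary together: eventually `|r| < c` for a fixed `c < 1`, and `c ^ N`
dominates. This makes the limits in `n` and in the parameters joint. -/
theorem tendsto_pow_of_tendsto_lt_one {X : Type*} {F : Filter X} {r : X → ℝ} {N : X → ℕ} {r₀ : ℝ}
    (hr : Tendsto r F (𝓝 r₀)) (h : |r₀| < 1) (hN : Tendsto N F atTop) :
    Tendsto (fun x => r x ^ N x) F (𝓝 0) := by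
  obtain ⟨c, hc, hc1⟩ := exists_between h
  have hc0 : 0 ≤ c := (abs_nonneg _).trans hc.le
  refine squeeze_zero_norm' ?_ ((tendsto_pow_atTop_nhds_zero_of_lt_one hc0 hc1).comp hN)
  filter_upwards [hr.abs.eventually (gt_mem_nhds hc)] with x hx
  rw [norm_pow, Real.norm_eq_abs]
  exact pow_le_pow_left₀ (abs_nonneg _) hx.le _

theorem tendsto_formalCorrelation (hq : 2 ≤ q) {i j : ℕ} (hij : j < i) {α : ℝ} (h0 : 0 ≤ α)
    (h1 : α ≤ 1) {X : Type*} {F : Filter X} {a b : X → ℝ} {N : X → ℕ}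
    (ha : Tendsto a F (𝓝 α)) (hb : Tendsto b F (𝓝 1)) (hN : Tendsto N F atTop) :
    Tendsto (fun x => formalCorrelation q (a x) (b x) (N x) i j) F
      (𝓝 (limitCorrelation q i j α)) := by
  have hq4 := pow_four_sub_one_ne_zero hq
  have hlt : decayRate q α 1 < 1 := by rw [decayRate_one hq]; exact decay_lt_one h1
  have hge : 0 ≤ decayRate q α 1 := by rw [decayRate_one hq]; exact decay_nonneg h0
  have hr : Tendsto (fun x => decayRate q (a x) (b x)) F (𝓝 (decayRate q α 1)) :=
    (((ha.mul hb).mul_const _).sub (ha.mul_const _)).div_const _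
  -- For arbitrary real parameters the rate may equal `1`, where `fixedVec` has no meaning; near the
  -- limit point it does not.
  have hne : ∀ᶠ x in F, decayRate q (a x) (b x) ≠ 1 := hr.eventually_ne hlt.ne
  have hw : Tendsto (fun x => fixedWeight q (a x) (b x)) F (𝓝 (fixedWeight q α 1)) :=
    ((((ha.mul hb).const_sub 1).mul_const _).div_const _).div (hr.const_sub 1)
      (sub_ne_zero.mpr hlt.ne')
  have hv : Tendsto (fun x => fixedVec q (a x) (b x)) F (𝓝 (fixedVec q α 1)) := by
    rw [tendsto_pi_nhds]
    intro x
    fin_cases x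
    · exact hw
    · exact (hw.const_mul _).const_sub 1
  have hT : Tendsto (fun x => transfer q (a x) (b x)) F (𝓝 (transfer q α 1)) := by
    refine tendsto_pi_nhds.mpr fun x => tendsto_pi_nhds.mpr fun y => ?_
    have hab := ha.mul hb
    fin_cases x <;> fin_cases y
    · exact ((ha.const_sub _).const_mul _).div_const _
    · exact ((hab.const_sub _).mul_const _).div_const _
    · exact (((ha.mul_const _).sub_const _).const_mul _).div_const _
    · exact ((hab.mul_const _).sub_const _).div_const _
  have hT0 : Tendsto (fun x => transferRead q (a x) (b x)) F (𝓝 (transferRead q α 1)) := by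
    refine tendsto_pi_nhds.mpr fun x => tendsto_pi_nhds.mpr fun y => ?_
    have hab := ha.mul hb
    fin_cases x <;> fin_cases y
    · exact ((ha.const_sub _).const_mul _).div_const _
    · exact ((hab.const_sub _).mul_const _).div_const _
    · exact (((ha.mul_const _).sub_const _).const_mul _).div_const _
    · exact ((hab.mul_const _).sub_const _).div_const _
  have hmv : ∀ {M : X → Matrix (Fin 2) (Fin 2) ℝ} {M₀ : Matrix (Fin 2) (Fin 2) ℝ}
      {v : X → Fin 2 → ℝ} {v₀ : Fin 2 → ℝ}, Tendsto M F (𝓝 M₀) → Tendsto v F (𝓝 v₀) →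
      Tendsto (fun x => M x *ᵥ v x) F (𝓝 (M₀ *ᵥ v₀)) := by
    intro M M₀ v v₀ hM hv
    have hc : Continuous fun p : Matrix (Fin 2) (Fin 2) ℝ × (Fin 2 → ℝ) => p.1 *ᵥ p.2 :=
      continuous_fst.matrix_mulVec continuous_snd
    exact (hc.tendsto (M₀, v₀)).comp (hM.prodMk_nhds hv)
  have hdot : ∀ {v : X → Fin 2 → ℝ} {v₀ : Fin 2 → ℝ}, Tendsto v F (𝓝 v₀) →
      Tendsto (fun x => traceRow q ⬝ᵥ v x) F (𝓝 (traceRow q ⬝ᵥ v₀)) := by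
    intro v v₀ hv
    have hc : Continuous fun p : Fin 2 → ℝ => traceRow q ⬝ᵥ p :=
      continuous_const.dotProduct continuous_id
    exact (hc.tendsto v₀).comp hv
  have hpow : ∀ l : ℕ, Tendsto (fun x => transfer q (a x) (b x) ^ (N x - l - 1) *ᵥ
      ![1 / (q : ℝ), 0]) F (𝓝 (fixedVec q α 1)) := by
    intro l
    have hN' : Tendsto (fun x => N x - l - 1) F atTop :=
      ((tendsto_sub_atTop_nat 1).comp (tendsto_sub_atTop_nat l)).comp hN
    have h2 := tendsto_pow_of_tendsto_lt_one hr (by rwa [abs_of_nonneg hge]) hN'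
    -- The initial vector has the same normalisation as `fixedVec`, hence the limit is `fixedVec`
    -- itself.
    have hu : traceRow q ⬝ᵥ ![1 / (q : ℝ), 0] = 1 := by
      have : (q : ℝ) ≠ 0 := by norm_cast; omega
      simp [traceRow, this]
    have h3 := hv.add (h2.smul (hv.const_sub ![1 / (q : ℝ), 0]))
    rw [zero_smul, add_zero] at h3
    refine h3.congr' ?_
    filter_upwards [hne] with x hx
    rw [transfer_pow_mulVec hq hx, hu, one_smul]
  simp only [formalCorrelation_eq hq]
  rw [← fixedVec_correlation hq hij h1]
  exact (hdot (hmv hT0 (hmv (hT.pow _) (hmv hT0 (hpow i))))).sub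
    ((hdot (hmv hT0 (hpow i))).mul (hdot (hmv hT0 (hpow j))))

end Limit

end NoisyConv

/-! ### Assembly: the exact formula and the three limits -/

theorem mainTheorem9 (q : ℕ) (hq : 2 ≤ q) (i j : ℕ) (hj : 2 ≤ j) (hij : j < i) :
    -- for a physical noise channel, the correlation is the explicit function of `α` and `β`
    (∀ (E : NoisyConv.Noise q) (n : ℕ), i < n →
      NoisyConv.connectedCorrelation E n i j =
        NoisyConv.formalCorrelation q E.alpha E.beta n i j) ∧
    -- a physical noise channel with `β = 1`, in the limit `n → ∞`
    (∀ E : NoisyConv.Noise q, 0 ≤ E.alpha ∧ E.alpha ≤ 1 ∧ (E.beta = 1 →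
      Tendsto (fun n : ℕ => NoisyConv.connectedCorrelation E n i j) atTop
        (𝓝 ((1 - E.alpha) * (q : ℝ) ^ 2 * (E.alpha * (q : ℝ) ^ 2 - 1) /
            (((q : ℝ) + 1) ^ 2 * ((1 - E.alpha) * (q : ℝ) ^ 2 + 1) ^ 2) *
          (E.alpha * (q : ℝ) ^ 2 / ((q : ℝ) ^ 2 + 1)) ^ (i - j))))) ∧
    ∀ α : ℝ, 0 ≤ α → α ≤ 1 →
      -- the joint limit `n → ∞`, `β → 1` along physical noise channels with `α` tending to `α`
      Tendsto (fun p : ℕ × NoisyConv.Noise q => NoisyConv.connectedCorrelation p.2 p.1 i j)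
        (atTop ×ˢ comap (fun E : NoisyConv.Noise q => (E.alpha, E.beta)) (𝓝 (α, 1)))
        (𝓝 ((1 - α) * (q : ℝ) ^ 2 * (α * (q : ℝ) ^ 2 - 1) /
            (((q : ℝ) + 1) ^ 2 * ((1 - α) * (q : ℝ) ^ 2 + 1) ^ 2) *
          (α * (q : ℝ) ^ 2 / ((q : ℝ) ^ 2 + 1)) ^ (i - j))) ∧
      -- the joint limit `n → ∞`, `β → 1` at fixed `α`, with `α` and `β` as free parameters
      Tendsto (fun p : ℕ × ℝ => NoisyConv.formalCorrelation q α p.2 p.1 i j)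
        (atTop ×ˢ 𝓝 1)
        (𝓝 ((1 - α) * (q : ℝ) ^ 2 * (α * (q : ℝ) ^ 2 - 1) /
            (((q : ℝ) + 1) ^ 2 * ((1 - α) * (q : ℝ) ^ 2 + 1) ^ 2) *
          (α * (q : ℝ) ^ 2 / ((q : ℝ) ^ 2 + 1)) ^ (i - j))) ∧
      -- the decay in the distance is exponential
      0 ≤ α * (q : ℝ) ^ 2 / ((q : ℝ) ^ 2 + 1) ∧ α * (q : ℝ) ^ 2 / ((q : ℝ) ^ 2 + 1) < 1 := by
  refine ⟨fun E n hn => NoisyConv.connectedCorrelation_eq_formalCorrelation hq E hj hij hn,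
    fun E => ⟨E.alpha_nonneg, E.alpha_le_one, fun hβ => ?_⟩, fun α h0 h1 => ⟨?_, ?_,
      NoisyConv.decay_nonneg h0, NoisyConv.decay_lt_one h1⟩⟩
  · refine (NoisyConv.tendsto_formalCorrelation hq hij E.alpha_nonneg E.alpha_le_one
      (tendsto_const_nhds (x := E.alpha)) (b := fun _ => E.beta)
      (by rw [hβ]; exact tendsto_const_nhds)
      tendsto_id).congr' ?_
    -- The transfer formula for the circuit holds only for `n > i`, which is enough for a limit.
    filter_upwards [eventually_gt_atTop i] with n hn
    exact (NoisyConv.connectedCorrelation_eq_formalCorrelation hq E hj hij hn).symm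
  · have hc : Tendsto (fun p : ℕ × NoisyConv.Noise q => (p.2.alpha, p.2.beta))
        (atTop ×ˢ comap (fun E : NoisyConv.Noise q => (E.alpha, E.beta)) (𝓝 (α, 1)))
        (𝓝 (α, 1)) := tendsto_comap.comp tendsto_snd
    refine (NoisyConv.tendsto_formalCorrelation hq hij h0 h1
      ((continuous_fst.tendsto _).comp hc) ((continuous_snd.tendsto _).comp hc)
      tendsto_fst).congr' ?_
    filter_upwards [tendsto_fst.eventually (eventually_gt_atTop i)] with p hp
    exact (NoisyConv.connectedCorrelation_eq_formalCorrelation hq p.2 hj hij hp).symm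
  · exact NoisyConv.tendsto_formalCorrelation hq hij h0 h1 tendsto_const_nhds tendsto_snd
      tendsto_fst
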